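/- All semirings are commutative with $0$ and $1$. A semiring scheme $(X,\mathcal O_X)$ is a topological space with a sheaf of semirings that is locally isomorphic to prime spectra $(\operatorname{Spec} R,\mathcal O_{\operatorname{Spec} R})$ of semirings $R$, where a section of $\mathcal O_{\operatorname{Spec} R}$ over $U$ is a function $s$ on $U$ with $s(\mathfrak p)\in R_{\mathfrak p}$ that is locally a fraction of elements of $R$. A sheaf $\mathcal L$ of $\mathcal O_X$-semimodules is invertible if it is locally isomorphic to $\mathcal O_X$. For sheaves of $\mathcal O_X$-semimodules $\mathcal F,\mathcal G$, let $\mathcal F\otimes_{\mathcal O_X}\mathcal G$ be the sheafification of $U\mapsto \mathcal F(U)\otimes_{\mathcal O_X(U)}\mathcal G(U)$, where $\otimes$ is the tensor product of semimodules that represents bilinear maps (Pareigis–Röhrl). Let $\operatorname{Pic}(X)$ be the set of isomorphism classes of invertible sheaves of $\mathcal O_X$-semimodules, with the product $[\mathcal L][\mathcal M]=[\mathcal L\otimes_{\mathcal O_X}\mathcal M]$. Let $\mathcal O_X^*$ be the sheaf of abelian groups $U\mapsto \mathcal O_X(U)^\times$, written multiplicatively. For an open covering $\mathcal U=\{U_i\}_{i\in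 I}$ of $X$ with $I$ totally ordered, put $C^n=\prod_{i_0<\dots<i_n}\mathcal O_X^*(U_{i_0}\cap\dots\cap U_{i_n})$ and, omitting restrictions, $$(d_0^+x)_{ij}=x_j,\quad (d_0^-x)_{ij}=x_i,\quad (d_1^+x)_{ijk}=x_{jk}x_{ij},\quad (d_1^-x)_{ijk}=x_{ik}.$$ Let $Z^1(\mathcal U)=\{x\in C^1: d_1^+x=d_1^-x\}$ and $\check H^1(\mathcal U,\mathcal O_X^*)=Z^1(\mathcal U)/\rho$, where $x\mathrel{\rho}y$ if and only if $x\cdot d_0^+u\cdot d_0^-v=y\cdot d_0^+v\cdot d_0^-u$ for some $u,v\in C^0$. If $\mathcal V=\{V_j\}_{j\in J}$ is a refinement of $\mathcal U$ by means of $\sigma:J\to I$, with $V_j\subseteq U_{\sigma(j)}$, then $x\mapsto (x_{\sigma(j)\sigma(k)})_{j<k}$, with the convention $x_{ii}=1$ and $x_{ji}=x_{ij}^{-1}$, induces a homomorphism $\check H^1(\mathcal U,\mathcal O_X^*)\to\check H^1(\mathcal V,\mathcal O_X^*)$, which does not depend on $\sigma$. Let $\check H^1(X,\mathcal O_X^*)=\varinjlim_{\mathcal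 U}\check H^1(\mathcal U,\mathcal O_X^*)$ over all open coverings, directed by refinement. **Theorem.** Let $X$ be a semiring scheme. Then $\operatorname{Pic}(X)$ is an abelian group with identity $[\mathcal O_X]$, and there is an isomorphism of groups $$\phi:\operatorname{Pic}(X)\xrightarrow{\ \sim\ }\check H^1(X,\mathcal O_X^*)$$ with the following property. Let $\mathcal L$ be an invertible sheaf, $\mathcal U=\{U_i\}_{i\in I}$ an open covering of $X$ with $I$ totally ordered, $\varphi_i:\mathcal O_X|_{U_i}\cong\mathcal L|_{U_i}$ isomorphisms, and $e_i=\varphi_i(1)\in\mathcal L(U_i)$. Then there is $f=(f_{ij})_{i<j}\in Z^1(\mathcal U)$ with $e_i|_{U_i\cap U_j}=f_{ij}\,e_j|_{U_i\cap U_j}$ for all $i<j$, and $\phi([\mathcal L])$ is the class of $f$. -/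

import Mathlib

open CategoryTheory TopologicalSpace Opposite
open scoped TensorProduct

universe u

namespace SemiringGeometry

/-! ## Semiringed spaces and semiring schemes -/

/-- A topological space with a sheaf of commutative semirings. -/
structure SemiringedSpace where
  carrier : TopCat.{u}
  sheaf : TopCat.Sheaf CommSemiRingCat.{u} carrier

/-- The semiring `𝒪_X(U)`. -/
abbrev SemiringedSpace.sec (X : SemiringedSpace.{u}) (U : Opens X.carrier) : Type u :=
  X.sheaf.presheaf.obj (op U)

/-- The restriction map `𝒪_X(U) → 𝒪_X(V)` for `V ⊆ U`. -/
def SemiringedSpace.res (X : SemiringedSpace.{u}) {U V : Opens X.carrier} (h : V ≤ U) :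
    X.sec U →+* X.sec V :=
  (X.sheaf.presheaf.map (homOfLE h).op).hom

section SheafFacts

variable (X : SemiringedSpace.{u})

@[simp]
theorem SemiringedSpace.res_self {U : Opens X.carrier} (h : U ≤ U) (a : X.sec U) :
    X.res h a = a := by
  simp [SemiringedSpace.res]

@[simp]
theorem SemiringedSpace.res_res {U V W : Opens X.carrier} (h : V ≤ U) (h' : W ≤ V)
    (a : X.sec U) : X.res h' (X.res h a) = X.res (h'.trans h) a := by
  have : (homOfLE (h'.trans h)).op = (homOfLE h).op ≫ (homOfLE h').op := rfl
  simp [SemiringedSpace.res, this]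

theorem SemiringedSpace.eq_of_locally_eq {U : Opens X.carrier} (a b : X.sec U)
    (H : ∀ x ∈ U, ∃ (V : Opens X.carrier) (h : V ≤ U), x ∈ V ∧ X.res h a = X.res h b) :
    a = b := by
  choose V h hx e using H
  exact X.sheaf.eq_of_locally_eq' (fun x : U => V x x.2) U (fun x => homOfLE (h x x.2))
    (fun x hxU => Opens.mem_iSup.2 ⟨⟨x, hxU⟩, hx x hxU⟩) a b (fun x => e x x.2)

theorem SemiringedSpace.exists_glue {ι : Type u} (U : ι → Opens X.carrier)
    (s : ∀ i, X.sec (U i))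
    (H : ∀ i j, X.res (inf_le_left : U i ⊓ U j ≤ U i) (s i) =
      X.res (inf_le_right : U i ⊓ U j ≤ U j) (s j)) :
    ∃ t : X.sec (iSup U), ∀ i, X.res (le_iSup U i) t = s i :=
  (X.sheaf.existsUnique_gluing U s H).exists

end SheafFacts

/-- `𝒪_{Spec R}(U)`: the functions `s` on `U` with `s(𝔭) ∈ R_𝔭` that are locally a quotient of two
elements of `R`. -/
def specSections (R : Type u) [CommSemiring R] (U : Opens (PrimeSpectrum R)) :
    Subsemiring (∀ p : U, Localization.AtPrime p.1.asIdeal) where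
  carrier := {s | ∀ p : U, ∃ V : Opens (PrimeSpectrum R), p.1 ∈ V ∧ ∃ a b : R,
    ∀ q : U, q.1 ∈ V → ∃ hb : b ∈ q.1.asIdeal.primeCompl, s q = Localization.mk a ⟨b, hb⟩}
  mul_mem' := by
    intro s t hs ht p
    obtain ⟨V, hV, a, b, h⟩ := hs p
    obtain ⟨W, hW, c, d, k⟩ := ht p
    refine ⟨V ⊓ W, ⟨hV, hW⟩, a * c, b * d, fun q hq => ?_⟩
    obtain ⟨hb, e⟩ := h q hq.1
    obtain ⟨hd, e'⟩ := k q hq.2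
    exact ⟨mul_mem hb hd, by rw [Pi.mul_apply, e, e', Localization.mk_mul]; rfl⟩
  one_mem' := fun p => ⟨⊤, trivial, 1, 1, fun q _ =>
    ⟨one_mem _, by rw [Pi.one_apply, ← Localization.mk_one]; rfl⟩⟩
  add_mem' := by
    intro s t hs ht p
    obtain ⟨V, hV, a, b, h⟩ := hs p
    obtain ⟨W, hW, c, d, k⟩ := ht p
    refine ⟨V ⊓ W, ⟨hV, hW⟩, b * c + d * a, b * d, fun q hq => ?_⟩
    obtain ⟨hb, e⟩ := h q hq.1
    obtain ⟨hd, e'⟩ := k q hq.2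
    exact ⟨mul_mem hb hd, by rw [Pi.add_apply, e, e', Localization.add_mk]; rfl⟩
  zero_mem' := fun p => ⟨⊤, trivial, 0, 1, fun q _ =>
    ⟨one_mem _, by rw [Pi.zero_apply]; exact (Localization.mk_zero _).symm⟩⟩

/-- Restriction of sections of `𝒪_{Spec R}`. -/
def specRes (R : Type u) [CommSemiring R] {U V : Opens (PrimeSpectrum R)} (h : V ≤ U)
    (s : specSections R U) : specSections R V :=
  ⟨fun p => s.1 ⟨p.1, h p.2⟩, fun p => by
    obtain ⟨W, hW, a, b, k⟩ := s.2 ⟨p.1, h p.2⟩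
    exact ⟨W, hW, a, b, fun q hq => k ⟨q.1, h q.2⟩ hq⟩⟩

/-- An isomorphism of semiringed spaces `(U, 𝒪_X|_U) ≅ Spec R`: a homeomorphism together with
isomorphisms of the semirings of sections over corresponding open sets, compatible with
restrictions. -/
structure AffineChart (X : SemiringedSpace.{u}) (U : Opens X.carrier)
    (R : Type u) [CommSemiring R] where
  homeo : PrimeSpectrum R ≃ₜ U
  /-- the open subset of `X` corresponding to an open subset of `Spec R` -/
  image : Opens (PrimeSpectrum R) → Opens X.carrier
  coe_image : ∀ V, (image V : Set X.carrier) = (fun p => (homeo p : X.carrier)) '' V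
  equiv : ∀ V, specSections R V ≃+* X.sec (image V)
  naturality : ∀ {V W : Opens (PrimeSpectrum R)} (h : W ≤ V) (h' : image W ≤ image V)
    (s : specSections R V), equiv W (specRes R h s) = X.res h' (equiv V s)

/-- A semiring scheme: a semiringed space that is locally isomorphic to prime spectra of
commutative semirings. -/
structure SemiringScheme extends SemiringedSpace.{u} where
  locally_affine : ∀ x : carrier, ∃ U : Opens carrier, x ∈ U ∧
    ∃ (R : Type u) (_ : CommSemiring R), Nonempty (AffineChart toSemiringedSpace U R)

/-! ## Sheaves of semimodules -/

/-- A presheaf of `𝒪_X`-semimodules. -/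
structure SemimodulePresheaf (X : SemiringedSpace.{u}) where
  obj : Opens X.carrier → Type u
  [addCommMonoid : ∀ U, AddCommMonoid (obj U)]
  [module : ∀ U, Module (X.sec U) (obj U)]
  /-- restriction maps, semilinear along the restriction maps of `𝒪_X` -/
  res : ∀ {U V : Opens X.carrier} (h : V ≤ U), obj U →ₛₗ[X.res h] obj V
  res_self : ∀ {U : Opens X.carrier} (h : U ≤ U) (s : obj U), res h s = s
  res_res : ∀ {U V W : Opens X.carrier} (h : V ≤ U) (h' : W ≤ V) (s : obj U),
    res h' (res h s) = res (h'.trans h) s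

attribute [instance] SemimodulePresheaf.addCommMonoid SemimodulePresheaf.module
attribute [simp] SemimodulePresheaf.res_self SemimodulePresheaf.res_res

/-- A sheaf of `𝒪_X`-semimodules. -/
structure SemimoduleSheaf (X : SemiringedSpace.{u}) extends SemimodulePresheaf X where
  eq_of_locally_eq : ∀ {U : Opens X.carrier} (s t : obj U),
    (∀ x ∈ U, ∃ (V : Opens X.carrier) (h : V ≤ U), x ∈ V ∧ res h s = res h t) → s = t
  exists_glue : ∀ {ι : Type u} (U : ι → Opens X.carrier) (s : ∀ i, obj (U i)),
    (∀ i j, res (inf_le_left : U i ⊓ U j ≤ U i) (s i) =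
      res (inf_le_right : U i ⊓ U j ≤ U j) (s j)) →
    ∃ t : obj (iSup U), ∀ i, res (le_iSup U i) t = s i

/-- `𝒪_X` as a sheaf of semimodules over itself. -/
abbrev structureSheaf (X : SemiringedSpace.{u}) : SemimoduleSheaf X where
  obj U := X.sec U
  res h := { toFun := X.res h, map_add' := map_add _, map_smul' := fun a s => map_mul _ a s }
  res_self h s := X.res_self h s
  res_res h h' s := X.res_res h h' s
  eq_of_locally_eq := X.eq_of_locally_eq
  exists_glue := X.exists_glue

/-- An isomorphism `F|_U ≅ G|_U` of `𝒪_X|_U`-semimodules. -/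
structure IsoOver {X : SemiringedSpace.{u}} (U : Opens X.carrier)
    (F G : SemimodulePresheaf X) where
  equiv : ∀ V, V ≤ U → (F.obj V ≃ₗ[X.sec V] G.obj V)
  naturality : ∀ {V W : Opens X.carrier} (hV : V ≤ U) (h : W ≤ V) (s : F.obj V),
    equiv W (h.trans hV) (F.res h s) = G.res h (equiv V hV s)

/-- A sheaf of semimodules is invertible if it is locally isomorphic to `𝒪_X`. -/
def IsInvertible {X : SemiringedSpace.{u}} (L : SemimoduleSheaf X) : Prop :=
  ∀ x : X.carrier, ∃ U : Opens X.carrier, x ∈ U ∧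
    Nonempty (IsoOver U (structureSheaf X).toSemimodulePresheaf L.toSemimodulePresheaf)

/-! ## The tensor product of sheaves -/

section Tensor

variable {X : SemiringedSpace.{u}}

/-- The restriction map `F(U) ⊗ G(U) → F(V) ⊗ G(V)`, sending `s ⊗ t` to `s|_V ⊗ t|_V`. -/
noncomputable def tensorRes (F G : SemimodulePresheaf X) {U V : Opens X.carrier} (h : V ≤ U) :
    (F.obj U ⊗[X.sec U] G.obj U) →ₛₗ[X.res h] (F.obj V ⊗[X.sec V] G.obj V) :=
  TensorProduct.lift (LinearMap.mk₂'ₛₗ (X.res h) (X.res h)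
    (fun s t => F.res h s ⊗ₜ[X.sec V] G.res h t)
    (fun s s' t => by rw [map_add, TensorProduct.add_tmul])
    (fun a s t => by rw [LinearMap.map_smulₛₗ, TensorProduct.smul_tmul'])
    (fun s t t' => by rw [map_add, TensorProduct.tmul_add])
    (fun a s t => by rw [LinearMap.map_smulₛₗ, TensorProduct.tmul_smul]))

@[simp]
theorem tensorRes_tmul (F G : SemimodulePresheaf X) {U V : Opens X.carrier} (h : V ≤ U)
    (s : F.obj U) (t : G.obj U) :
    tensorRes F G h (s ⊗ₜ t) = F.res h s ⊗ₜ G.res h t := rfl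

/-- The presheaf `U ↦ F(U) ⊗_{𝒪_X(U)} G(U)`. Mathlib's tensor product of semimodules over a
commutative semiring is the one representing bilinear maps. -/
noncomputable def tensorPresheaf (F G : SemimodulePresheaf X) : SemimodulePresheaf X where
  obj U := F.obj U ⊗[X.sec U] G.obj U
  res h := tensorRes F G h
  res_self h s := by
    induction s using TensorProduct.induction_on with
    | zero => simp
    | tmul a b => simp
    | add a b ha hb => rw [map_add, ha, hb]
  res_res h h' s := by
    induction s using TensorProduct.induction_on with
    | zero => simp
    | tmul a b => simp
    | add a b ha hb => simp only [map_add, ha, hb]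

end Tensor

/-! ## Sheafification -/

section Sheafify

variable {X : SemiringedSpace.{u}} (P : SemimodulePresheaf X)

namespace SemimodulePresheaf

/-- An open neighbourhood of a point. -/
@[ext]
structure Nhds (x : X.carrier) where
  set : Opens X.carrier
  mem : x ∈ set

/-- Neighbourhoods are ordered by reverse inclusion. -/
instance (x : X.carrier) : Preorder (Nhds x) where
  le a b := b.set ≤ a.set
  le_refl a := le_refl a.set
  le_trans _ _ _ h h' := le_trans h' h

instance (x : X.carrier) : Nonempty (Nhds x) := ⟨⟨⊤, trivial⟩⟩

instance (x : X.carrier) : IsDirectedOrder (Nhds x) where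
  directed a b := ⟨⟨a.set ⊓ b.set, ⟨a.mem, b.mem⟩⟩,
    (inf_le_left : a.set ⊓ b.set ≤ _), (inf_le_right : a.set ⊓ b.set ≤ _)⟩

/-- The transition maps of the directed system defining the stalk. -/
def stalkMap (x : X.carrier) (a b : Nhds x) (h : a ≤ b) : P.obj a.set →+ P.obj b.set :=
  (P.res (show b.set ≤ a.set from h)).toAddMonoidHom

theorem stalkMap_apply (x : X.carrier) (a b : Nhds x) (h : a ≤ b) (s : P.obj a.set) :
    P.stalkMap x a b h s = P.res (show b.set ≤ a.set from h) s := rfl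

instance (x : X.carrier) :
    DirectedSystem (fun a : Nhds x => P.obj a.set) (P.stalkMap x · · ·) where
  map_self _ s := P.res_self _ s
  map_map _ _ _ _ _ s := P.res_res _ _ s

/-- The stalk of a presheaf of semimodules: the colimit of `P(U)` over the open neighbourhoods `U`
of the point. -/
abbrev stalk (x : X.carrier) : Type u :=
  DirectLimit (fun a : Nhds x => P.obj a.set) (P.stalkMap x)

/-- The germ at `x` of a section. -/
def germ {x : X.carrier} {U : Opens X.carrier} (hx : x ∈ U) (s : P.obj U) : P.stalk x :=
  Quotient.mk _ (Sigma.mk (β := fun a : Nhds x => P.obj a.set) ⟨U, hx⟩ s)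

variable {P}

theorem germ_res {x : X.carrier} {U V : Opens X.carrier} (h : V ≤ U) (hx : x ∈ V)
    (s : P.obj U) : P.germ hx (P.res h s) = P.germ (h hx) s :=
  (DirectLimit.eq_of_le (F := fun a : Nhds x => P.obj a.set) (f := P.stalkMap x)
    (Sigma.mk (β := fun a : Nhds x => P.obj a.set) ⟨U, h hx⟩ s) ⟨V, hx⟩ h).symm

theorem germ_ind {x : X.carrier} {p : P.stalk x → Prop} {U : Opens X.carrier} (hU : x ∈ U)
    (H : ∀ (V : Opens X.carrier) (_ : V ≤ U) (hx : x ∈ V) (s : P.obj V), p (P.germ hx s))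
    (z : P.stalk x) : p z := by
  obtain ⟨⟨V, hV⟩, s, rfl⟩ := DirectLimit.exists_eq_mk (P.stalkMap x) z
  have := H (V ⊓ U) inf_le_right ⟨hV, hU⟩ (P.res inf_le_left s)
  have e := germ_res (P := P) (inf_le_left : V ⊓ U ≤ V) ⟨hV, hU⟩ s
  rw [e] at this
  exact this

theorem germ_eq_iff {x : X.carrier} {U V : Opens X.carrier} (hU : x ∈ U) (hV : x ∈ V)
    (s : P.obj U) (t : P.obj V) : P.germ hU s = P.germ hV t ↔
      ∃ (W : Opens X.carrier) (_ : x ∈ W) (h : W ≤ U) (h' : W ≤ V), P.res h s = P.res h' t := by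
  constructor
  · intro e
    obtain ⟨⟨W, hW⟩, h, h', e⟩ := Quotient.exact e
    exact ⟨W, hW, h, h', e⟩
  · rintro ⟨W, hW, h, h', e⟩
    rw [← germ_res h hW, e, germ_res]

theorem germ_add {x : X.carrier} {U : Opens X.carrier} (hx : x ∈ U) (s t : P.obj U) :
    P.germ hx (s + t) = P.germ hx s + P.germ hx t :=
  (DirectLimit.add_def (G := fun a : Nhds x => P.obj a.set) (f := P.stalkMap x) ⟨U, hx⟩ s t).symm

theorem germ_zero {x : X.carrier} {U : Opens X.carrier} (hx : x ∈ U) :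
    P.germ hx (0 : P.obj U) = 0 :=
  (DirectLimit.zero_def (f := P.stalkMap x) (⟨U, hx⟩ : Nhds x)).symm

/-- The action of `𝒪_X(U)` on the stalk at a point `x` of `U`: the germ at `x` of a section `t`
over `V` is sent by `a` to the germ of `a|_{V ∩ U} • t|_{V ∩ U}`. -/
instance stalkSMul {U : Opens X.carrier} (x : U) : SMul (X.sec U) (P.stalk x.1) where
  smul a := DirectLimit.lift (P.stalkMap x.1)
    (fun i t => P.germ (U := i.set ⊓ U) (show x.1 ∈ i.set ⊓ U from ⟨i.mem, x.2⟩)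
      (X.res (inf_le_right : i.set ⊓ U ≤ U) a • P.res (inf_le_left : i.set ⊓ U ≤ i.set) t))
    (fun i j h t => (germ_eq_iff _ _ _ _).2
      ⟨j.set ⊓ U, ⟨j.mem, x.2⟩, inf_le_inf_right U h, le_rfl, by
        simp only [stalkMap_apply, LinearMap.map_smulₛₗ, X.res_res, P.res_res]⟩)

theorem smul_germ {U V : Opens X.carrier} (x : U) (h : V ≤ U) (hx : x.1 ∈ V) (a : X.sec U)
    (s : P.obj V) : a • P.germ hx s = P.germ hx (X.res h a • s) := by
  change P.germ (U := V ⊓ U) (show x.1 ∈ V ⊓ U from ⟨hx, x.2⟩)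
    (X.res (inf_le_right : V ⊓ U ≤ U) a • P.res (inf_le_left : V ⊓ U ≤ V) s) = _
  rw [germ_eq_iff]
  exact ⟨V ⊓ U, ⟨hx, x.2⟩, le_rfl, inf_le_left, by simp⟩

noncomputable instance stalkModule {U : Opens X.carrier} (x : U) : Module (X.sec U) (P.stalk x.1) where
  one_smul := germ_ind x.2 fun V h hx s => by rw [smul_germ x h, map_one, one_smul]
  mul_smul a b := germ_ind x.2 fun V h hx s => by
    rw [smul_germ x h, smul_germ x h, smul_germ x h, map_mul, mul_smul]
  smul_zero a := by
    rw [← germ_zero x.2, smul_germ x le_rfl, smul_zero]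
  smul_add a := germ_ind x.2 fun V h hx s => germ_ind hx fun W h' hx' t => by
    rw [← germ_res h' hx', ← germ_add, smul_germ x (h'.trans h), smul_germ x (h'.trans h),
      smul_germ x (h'.trans h), ← germ_add, smul_add]
  add_smul a b := germ_ind x.2 fun V h hx s => by
    rw [smul_germ x h, smul_germ x h, smul_germ x h, map_add, add_smul, germ_add]
  zero_smul := germ_ind x.2 fun V h hx s => by
    rw [smul_germ x h, map_zero, zero_smul, germ_zero]

variable (P)

/-- Sections over `U` of the sheafification: functions assigning to each `x ∈ U` an element of the
stalk at `x` that are locally given by germs of sections of the presheaf. -/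
noncomputable def sheafifySections (U : Opens X.carrier) : Submodule (X.sec U) (∀ x : U, P.stalk x.1) where
  carrier := {s | ∀ x : U, ∃ (V : Opens X.carrier) (h : V ≤ U) (_ : x.1 ∈ V) (t : P.obj V),
    ∀ (y : X.carrier) (hy : y ∈ V), s ⟨y, h hy⟩ = P.germ hy t}
  add_mem' := by
    intro s t hs ht x
    obtain ⟨V, hV, hx, a, ha⟩ := hs x
    obtain ⟨W, hW, hx', b, hb⟩ := ht x
    refine ⟨V ⊓ W, inf_le_left.trans hV, ⟨hx, hx'⟩,
      P.res inf_le_left a + P.res inf_le_right b, fun y hy => ?_⟩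
    rw [Pi.add_apply, ha y hy.1, hb y hy.2, germ_add, germ_res, germ_res]
  zero_mem' := fun x => ⟨U, le_rfl, x.2, 0, fun y hy => (germ_zero hy).symm⟩
  smul_mem' := by
    intro c s hs x
    obtain ⟨V, hV, hx, a, ha⟩ := hs x
    refine ⟨V, hV, hx, X.res hV c • a, fun y hy => ?_⟩
    rw [Pi.smul_apply, ha y hy, smul_germ ⟨y, hV hy⟩ hV]

theorem res_smul_stalk {U V : Opens X.carrier} (h : V ≤ U) (x : V) (a : X.sec U)
    (z : P.stalk x.1) : X.res h a • z = (a • (show P.stalk (⟨x.1, h x.2⟩ : U).1 from z)) := by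
  revert z
  refine germ_ind x.2 fun W hW hx s => ?_
  rw [smul_germ x hW]
  refine Eq.trans ?_ (smul_germ (⟨x.1, h x.2⟩ : U) (hW.trans h) hx a s).symm
  simp

/-- The sheafification of a presheaf of semimodules. -/
noncomputable def sheafify : SemimoduleSheaf X where
  obj U := P.sheafifySections U
  res {U V} h :=
    { toFun := fun s => ⟨fun x => s.1 ⟨x.1, h x.2⟩, fun x => by
        obtain ⟨W, hW, hx, t, ht⟩ := s.2 ⟨x.1, h x.2⟩
        exact ⟨W ⊓ V, inf_le_right, ⟨hx, x.2⟩, P.res inf_le_left t, fun y hy => by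
          rw [germ_res]; exact ht y hy.1⟩⟩
      map_add' := fun _ _ => rfl
      map_smul' := fun a s => Subtype.ext (funext fun x =>
        (P.res_smul_stalk h x a (s.1 ⟨x.1, h x.2⟩)).symm) }
  res_self _ _ := rfl
  res_res _ _ _ := rfl
  eq_of_locally_eq s t H := Subtype.ext (funext fun x => by
    obtain ⟨V, h, hx, e⟩ := H x.1 x.2
    exact congrFun (congrArg Subtype.val e) ⟨x.1, hx⟩)
  exists_glue U s H := by
    have key : ∀ x : (iSup U : Opens X.carrier), ∃ i, x.1 ∈ U i := fun x => Opens.mem_iSup.1 x.2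
    choose i hi using key
    have agree : ∀ (x : (iSup U : Opens X.carrier)) (j) (hj : x.1 ∈ U j),
        (s (i x)).1 ⟨x.1, hi x⟩ = (s j).1 ⟨x.1, hj⟩ := fun x j hj =>
      congrFun (congrArg Subtype.val (H (i x) j)) ⟨x.1, hi x, hj⟩
    refine ⟨⟨fun x => (s (i x)).1 ⟨x.1, hi x⟩, fun x => ?_⟩, fun j => Subtype.ext (funext fun x =>
      agree ⟨x.1, le_iSup U j x.2⟩ j x.2)⟩
    obtain ⟨V, h, hx, t, ht⟩ := (s (i x)).2 ⟨x.1, hi x⟩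
    exact ⟨V, h.trans (le_iSup U _), hx, t, fun y hy =>
      (agree ⟨y, le_iSup U (i x) (h hy)⟩ (i x) (h hy)).trans (ht y hy)⟩

end SemimodulePresheaf

/-- The tensor product `F ⊗_{𝒪_X} G` of sheaves of semimodules. -/
noncomputable def tensorSheaf (F G : SemimoduleSheaf X) : SemimoduleSheaf X :=
  (tensorPresheaf F.toSemimodulePresheaf G.toSemimodulePresheaf).sheafify

end Sheafify

/-! ## Invertible sheaves and the Picard group -/

section Picard

variable {X : SemiringedSpace.{u}}

/-- The canonical map from a presheaf to its sheafification. -/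
noncomputable def SemimodulePresheaf.toSheafify (P : SemimodulePresheaf X) (U : Opens X.carrier) :
    P.obj U →ₗ[X.sec U] P.sheafify.obj U where
  toFun s := ⟨fun x => P.germ x.2 s, fun x => ⟨U, le_rfl, x.2, s, fun _ _ => rfl⟩⟩
  map_add' s t := Subtype.ext (funext fun x => SemimodulePresheaf.germ_add x.2 s t)
  map_smul' a s := Subtype.ext (funext fun x => by
    refine Eq.trans ?_ (SemimodulePresheaf.smul_germ x le_rfl x.2 a s).symm
    rw [X.res_self])

/-- Restriction of an isomorphism to a smaller open set. -/
def IsoOver.restrict {U V : Opens X.carrier} {F G : SemimodulePresheaf X} (e : IsoOver U F G)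
    (h : V ≤ U) : IsoOver V F G where
  equiv W hW := e.equiv W (hW.trans h)
  naturality hV h' s := e.naturality (hV.trans h) h' s

/-- A presheaf of semimodules isomorphic over `U` to a sheaf is isomorphic over `U` to its
sheafification. -/
noncomputable def IsoOver.sheafify {U : Opens X.carrier} {F : SemimoduleSheaf X}
    {P : SemimodulePresheaf X} (e : IsoOver U F.toSemimodulePresheaf P) :
    IsoOver U F.toSemimodulePresheaf P.sheafify.toSemimodulePresheaf where
  equiv V hV := LinearEquiv.ofBijective ((P.toSheafify V).comp (e.equiv V hV).toLinearMap) (by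
    constructor
    · intro s t h
      refine F.eq_of_locally_eq s t fun x hx => ?_
      have h' : P.germ hx (e.equiv V hV s) = P.germ hx (e.equiv V hV t) :=
        congrFun (congrArg Subtype.val h) ⟨x, hx⟩
      obtain ⟨W, hW, k, _, E⟩ := (SemimodulePresheaf.germ_eq_iff hx hx _ _).1 h'
      refine ⟨W, k, hW, (e.equiv W (k.trans hV)).injective ?_⟩
      rw [e.naturality hV, e.naturality hV, E]
    · intro s
      choose W hW hx t ht using s.2
      let a : ∀ x : V, F.obj (W x) := fun x => (e.equiv (W x) ((hW x).trans hV)).symm (t x)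
      have ha : ∀ x, e.equiv (W x) ((hW x).trans hV) (a x) = t x := fun x =>
        LinearEquiv.apply_symm_apply _ _
      obtain ⟨b, hb⟩ := F.exists_glue W a (fun x y => by
        refine F.eq_of_locally_eq _ _ fun z hz => ?_
        have h1 : P.germ hz.1 (t x) = P.germ hz.2 (t y) :=
          (ht x z hz.1).symm.trans (ht y z hz.2)
        obtain ⟨N, hN, k, k', E⟩ := (SemimodulePresheaf.germ_eq_iff _ _ _ _).1 h1
        refine ⟨N, le_inf k k', hN, ?_⟩
        rw [F.res_res, F.res_res]
        apply (e.equiv N (k.trans ((hW x).trans hV))).injective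
        rw [e.naturality ((hW x).trans hV), e.naturality ((hW y).trans hV), ha, ha, E])
      have hVW : V ≤ iSup W := fun z hz => Opens.mem_iSup.2 ⟨⟨z, hz⟩, hx ⟨z, hz⟩⟩
      refine ⟨F.res hVW b, Subtype.ext (funext fun x => ?_)⟩
      change P.germ x.2 (e.equiv V hV (F.res hVW b)) = _
      rw [← SemimodulePresheaf.germ_res (hW x) (hx x), ← e.naturality hV, F.res_res, hb, ha]
      exact (ht x x.1 (hx x)).symm)
  naturality {V W} hV h s := Subtype.ext (funext fun x => by
    change P.germ x.2 (e.equiv W (h.trans hV) (F.res h s)) = P.germ (h x.2) (e.equiv V hV s)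
    rw [e.naturality hV, SemimodulePresheaf.germ_res])

/-- Isomorphisms `𝒪_X|_U ≅ F|_U` and `𝒪_X|_U ≅ G|_U` give `𝒪_X|_U ≅ (F ⊗ G)|_U` for the tensor
product presheaf. -/
noncomputable def IsoOver.tensor {U : Opens X.carrier} {F G : SemimodulePresheaf X}
    (e : IsoOver U (structureSheaf X).toSemimodulePresheaf F)
    (e' : IsoOver U (structureSheaf X).toSemimodulePresheaf G) :
    IsoOver U (structureSheaf X).toSemimodulePresheaf (tensorPresheaf F G) where
  equiv V hV := (TensorProduct.lid (X.sec V) (X.sec V)).symm.trans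
    (TensorProduct.congr (e.equiv V hV) (e'.equiv V hV))
  naturality {V W} hV h s := by
    have h1 := e.naturality hV h (1 : X.sec V)
    have h2 : (structureSheaf X).res h (1 : X.sec V) = (1 : X.sec W) := map_one (X.res h)
    rw [h2] at h1
    exact congrArg₂ (fun a b => a ⊗ₜ[X.sec W] b) h1 (e'.naturality hV h s)

theorem isInvertible_structureSheaf (X : SemiringedSpace.{u}) :
    IsInvertible (structureSheaf X) := fun _ =>
  ⟨⊤, trivial, ⟨{ equiv := fun _ _ => LinearEquiv.refl _ _, naturality := fun _ _ _ => rfl }⟩⟩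

theorem IsInvertible.tensor {F G : SemimoduleSheaf X} (hF : IsInvertible F)
    (hG : IsInvertible G) : IsInvertible (tensorSheaf F G) := fun x => by
  obtain ⟨U, hU, ⟨e⟩⟩ := hF x
  obtain ⟨V, hV, ⟨e'⟩⟩ := hG x
  exact ⟨U ⊓ V, ⟨hU, hV⟩,
    ⟨((e.restrict inf_le_left).tensor (e'.restrict inf_le_right)).sheafify⟩⟩

variable (X) in
/-- The invertible sheaves of `𝒪_X`-semimodules. -/
abbrev InvertibleSheaf : Type (u + 1) := {L : SemimoduleSheaf X // IsInvertible L}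

/-- `𝒪_X` as an invertible sheaf. -/
def InvertibleSheaf.unit (X : SemiringedSpace.{u}) : InvertibleSheaf X :=
  ⟨structureSheaf X, isInvertible_structureSheaf X⟩

/-- The tensor product of invertible sheaves. -/
noncomputable def InvertibleSheaf.tensor (L M : InvertibleSheaf X) : InvertibleSheaf X :=
  ⟨tensorSheaf L.1 M.1, L.2.tensor M.2⟩

variable (X) in
/-- Isomorphism of invertible sheaves on `X`. -/
instance InvertibleSheaf.setoid : Setoid (InvertibleSheaf X) where
  r L M := Nonempty (IsoOver ⊤ L.1.toSemimodulePresheaf M.1.toSemimodulePresheaf)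
  iseqv :=
    { refl := fun _ =>
        ⟨{ equiv := fun _ _ => LinearEquiv.refl _ _, naturality := fun _ _ _ => rfl }⟩
      symm := fun {L M} ⟨e⟩ =>
        ⟨{ equiv := fun V hV => (e.equiv V hV).symm
           naturality := fun {V W} hV h s => by
            rw [LinearEquiv.symm_apply_eq, e.naturality hV, LinearEquiv.apply_symm_apply] }⟩
      trans := fun {L M N} ⟨e⟩ ⟨e'⟩ =>
        ⟨{ equiv := fun V hV => (e.equiv V hV).trans (e'.equiv V hV)
           naturality := fun {V W} hV h s => by
            simp only [LinearEquiv.trans_apply]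
            rw [e.naturality hV, e'.naturality hV] }⟩ }

variable (X) in
/-- The set of isomorphism classes of invertible sheaves on `X`. -/
def Pic : Type (u + 1) := Quotient (InvertibleSheaf.setoid X)

/-- The isomorphism class of an invertible sheaf. -/
def InvertibleSheaf.isoClass (L : InvertibleSheaf X) : Pic X := Quotient.mk _ L

end Picard

/-! ## Cohomology of a complex with pairs of coboundary maps

For abelian groups, written multiplicatively, and pairs of homomorphisms `d₀⁺, d₀⁻ : A → B` and
`d₁⁺, d₁⁻ : B → C`. -/

section PairCohomology

variable {A B C : Type*} [CommGroup A] [CommGroup B] [CommGroup C]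

/-- The cocycles: the elements `x` of `B` with `d₁⁺ x = d₁⁻ x`. -/
abbrev pairCocycles (dp dm : B →* C) : Subgroup B := dp.eqLocus dm

/-- The congruence `ρ` on cocycles: `x ρ y` if and only if
`x · d₀⁺ u · d₀⁻ v = y · d₀⁺ v · d₀⁻ u` for some `u, v`. -/
def pairCon (ep em : A →* B) (Z : Subgroup B) : Con Z where
  r x y := ∃ u v : A, (x : B) * ep u * em v = y * ep v * em u
  iseqv :=
    { refl := fun _ => ⟨1, 1, rfl⟩
      symm := fun ⟨u, v, h⟩ => ⟨v, u, h.symm⟩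
      trans := fun {x y z} ⟨u, v, h⟩ ⟨u', v', h'⟩ => ⟨u * u', v * v', by
        simp only [map_mul]
        calc (x : B) * (ep u * ep u') * (em v * em v')
            = (x * ep u * em v) * (ep u' * em v') := by
              simp only [mul_left_comm, mul_comm]
          _ = (y * ep u' * em v') * (ep v * em u) := by
              rw [h]; simp only [mul_left_comm, mul_comm]
          _ = z * (ep v * ep v') * (em u * em u') := by
              rw [h']; simp only [mul_left_comm, mul_comm]⟩ }
  mul' := fun {w x y z} ⟨u, v, h⟩ ⟨u', v', h'⟩ => ⟨u * u', v * v', by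
    simp only [map_mul, Subgroup.coe_mul]
    calc (w * y : B) * (ep u * ep u') * (em v * em v')
        = (w * ep u * em v) * (y * ep u' * em v') := by
          simp only [mul_assoc, mul_left_comm, mul_comm]
      _ = (x * z : B) * (ep v * ep v') * (em u * em u') := by
          rw [h, h']; simp only [mul_assoc, mul_left_comm, mul_comm]⟩

/-- The cohomology group: cocycles modulo `ρ`. -/
abbrev PairCohomology (ep em : A →* B) (dp dm : B →* C) : Type _ :=
  (pairCon ep em (pairCocycles dp dm)).Quotient

theorem pairCon_iff (ep em : A →* B) (Z : Subgroup B) (x y : Z) :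
    pairCon ep em Z x y ↔ ∃ w : A, (x : B) * em w = y * ep w := by
  constructor
  · rintro ⟨u, v, h⟩
    refine ⟨v * u⁻¹, ?_⟩
    have h' : (x : B) * em v = y * ep v * em u * (ep u)⁻¹ := by
      rw [← h, mul_right_comm, mul_inv_cancel_right]
    rw [map_mul, map_mul, map_inv, map_inv, ← mul_assoc, h', mul_right_comm (_ * _) (em u),
      mul_inv_cancel_right, mul_assoc]
  · rintro ⟨w, h⟩
    exact ⟨1, w, by simpa using h⟩

end PairCohomology

/-! ## Čech cohomology of the sheaf of units -/

section Cech

variable {X : SemiringedSpace.{u}}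

/-- The group `𝒪_X^*(U)` of invertible elements of `𝒪_X(U)`. -/
abbrev SemiringedSpace.units (X : SemiringedSpace.{u}) (U : Opens X.carrier) : Type u :=
  (X.sec U)ˣ

/-- The restriction maps of `𝒪_X^*`. -/
def SemiringedSpace.unitsRes (X : SemiringedSpace.{u}) {U V : Opens X.carrier} (h : V ≤ U) :
    X.units U →* X.units V :=
  Units.map (X.res h : X.sec U →* X.sec V)

@[simp]
theorem SemiringedSpace.coe_unitsRes {U V : Opens X.carrier} (h : V ≤ U) (a : X.units U) :
    (X.unitsRes h a : X.sec V) = X.res h a := rfl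

@[simp]
theorem SemiringedSpace.unitsRes_self {U : Opens X.carrier} (h : U ≤ U) (a : X.units U) :
    X.unitsRes h a = a := Units.ext (X.res_self h a)

@[simp]
theorem SemiringedSpace.unitsRes_res {U V W : Opens X.carrier} (h : V ≤ U) (h' : W ≤ V)
    (a : X.units U) : X.unitsRes h' (X.unitsRes h a) = X.unitsRes (h'.trans h) a :=
  Units.ext (X.res_res h h' a)

variable (X) in
/-- An open covering of `X` indexed by a totally ordered set. -/
structure OpenCover where
  ι : Type u
  [linearOrder : LinearOrder ι]
  set : ι → Opens X.carrier
  exists_mem : ∀ x : X.carrier, ∃ i, x ∈ set i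

attribute [instance] OpenCover.linearOrder

namespace OpenCover

variable (𝒰 𝒱 : OpenCover X)

/-- The pairs `i < j` of indices. -/
abbrev Pairs : Type u := {p : 𝒰.ι × 𝒰.ι // p.1 < p.2}

/-- The triples `i < j < k` of indices. -/
abbrev Triples : Type u := {t : 𝒰.ι × 𝒰.ι × 𝒰.ι // t.1 < t.2.1 ∧ t.2.1 < t.2.2}

/-- `U_{ij} = U_i ∩ U_j`. -/
abbrev inter₂ (i j : 𝒰.ι) : Opens X.carrier := 𝒰.set i ⊓ 𝒰.set j

/-- `U_{ijk} = U_i ∩ U_j ∩ U_k`. -/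
abbrev inter₃ (i j k : 𝒰.ι) : Opens X.carrier := 𝒰.set i ⊓ 𝒰.set j ⊓ 𝒰.set k

/-- `C⁰(𝒰, 𝒪_X^*) = ∏_i 𝒪_X^*(U_i)`. -/
abbrev C0 : Type u := ∀ i : 𝒰.ι, X.units (𝒰.set i)

/-- `C¹(𝒰, 𝒪_X^*) = ∏_{i < j} 𝒪_X^*(U_{ij})`. -/
abbrev C1 : Type u := ∀ p : 𝒰.Pairs, X.units (𝒰.inter₂ p.1.1 p.1.2)

/-- `C²(𝒰, 𝒪_X^*) = ∏_{i < j < k} 𝒪_X^*(U_{ijk})`. -/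
abbrev C2 : Type u := ∀ t : 𝒰.Triples, X.units (𝒰.inter₃ t.1.1 t.1.2.1 t.1.2.2)

/-- `(d₀⁺ x)_{ij} = x_j`. -/
def d0p : 𝒰.C0 →* 𝒰.C1 where
  toFun x p := X.unitsRes inf_le_right (x p.1.2)
  map_one' := funext fun _ => map_one _
  map_mul' _ _ := funext fun _ => map_mul _ _ _

/-- `(d₀⁻ x)_{ij} = x_i`. -/
def d0m : 𝒰.C0 →* 𝒰.C1 where
  toFun x p := X.unitsRes inf_le_left (x p.1.1)
  map_one' := funext fun _ => map_one _
  map_mul' _ _ := funext fun _ => map_mul _ _ _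

theorem inter₃_le_left (i j k : 𝒰.ι) : 𝒰.inter₃ i j k ≤ 𝒰.inter₂ i j := inf_le_left

theorem inter₃_le_right (i j k : 𝒰.ι) : 𝒰.inter₃ i j k ≤ 𝒰.inter₂ j k :=
  inf_le_inf_right _ inf_le_right

theorem inter₃_le_outer (i j k : 𝒰.ι) : 𝒰.inter₃ i j k ≤ 𝒰.inter₂ i k :=
  inf_le_inf_right _ inf_le_left

/-- `(d₁⁺ x)_{ijk} = x_{jk} x_{ij}`. -/
def d1p : 𝒰.C1 →* 𝒰.C2 where
  toFun x t := X.unitsRes (𝒰.inter₃_le_right _ _ _) (x ⟨(t.1.2.1, t.1.2.2), t.2.2⟩) *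
    X.unitsRes (𝒰.inter₃_le_left _ _ _) (x ⟨(t.1.1, t.1.2.1), t.2.1⟩)
  map_one' := by
    funext t
    simp only [Pi.one_apply, map_one, mul_one]
  map_mul' x y := by
    funext t
    simp only [Pi.mul_apply, map_mul]
    exact mul_mul_mul_comm _ _ _ _

/-- `(d₁⁻ x)_{ijk} = x_{ik}`. -/
def d1m : 𝒰.C1 →* 𝒰.C2 where
  toFun x t := X.unitsRes (𝒰.inter₃_le_outer _ _ _) (x ⟨(t.1.1, t.1.2.2), t.2.1.trans t.2.2⟩)
  map_one' := funext fun _ => map_one _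
  map_mul' _ _ := funext fun _ => map_mul _ _ _

/-- `Z¹(𝒰, 𝒪_X^*)`. -/
abbrev Z1 : Subgroup 𝒰.C1 := pairCocycles 𝒰.d1p 𝒰.d1m

/-- `Ȟ¹(𝒰, 𝒪_X^*)`. -/
abbrev H1 : Type u := PairCohomology 𝒰.d0p 𝒰.d0m 𝒰.d1p 𝒰.d1m

/-- The alternating extension of a `1`-cochain to all pairs of indices: `f_{ij}` if `i < j`,
`f_{ji}⁻¹` if `j < i`, and `1` if `i = j`. -/
def ext (i j : 𝒰.ι) : 𝒰.C1 →* X.units (𝒰.inter₂ i j) :=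
  if h : i < j then Pi.evalMonoidHom _ (⟨(i, j), h⟩ : 𝒰.Pairs)
  else if h : j < i then
    invMonoidHom.comp ((X.unitsRes (le_inf inf_le_right inf_le_left)).comp
      (Pi.evalMonoidHom _ (⟨(j, i), h⟩ : 𝒰.Pairs)))
  else 1

variable {𝒰 𝒱}

theorem ext_of_lt {i j : 𝒰.ι} (h : i < j) (f : 𝒰.C1) : 𝒰.ext i j f = f ⟨(i, j), h⟩ := by
  rw [ext, dif_pos h]; rfl

theorem ext_of_gt {i j : 𝒰.ι} (h : j < i) (f : 𝒰.C1) :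
    𝒰.ext i j f = (X.unitsRes (le_inf inf_le_right inf_le_left) (f ⟨(j, i), h⟩))⁻¹ := by
  rw [ext, dif_neg h.not_gt, dif_pos h]; rfl

theorem ext_self (i : 𝒰.ι) (f : 𝒰.C1) : 𝒰.ext i i f = 1 := by
  rw [ext, dif_neg (lt_irrefl i), dif_neg (lt_irrefl i)]; rfl

/-- The restriction of the alternating extension to an open subset of `U_i ∩ U_j`. -/
def extOn {W : Opens X.carrier} {i j : 𝒰.ι} (hi : W ≤ 𝒰.set i) (hj : W ≤ 𝒰.set j) (f : 𝒰.C1) :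
    X.units W := X.unitsRes (le_inf hi hj) (𝒰.ext i j f)

section extOn

variable {W : Opens X.carrier} {i j k : 𝒰.ι} (hi : W ≤ 𝒰.set i) (hj : W ≤ 𝒰.set j)
  (hk : W ≤ 𝒰.set k) (f : 𝒰.C1)

theorem extOn_self (hi' : W ≤ 𝒰.set i) : extOn hi hi' f = 1 := by
  rw [extOn, ext_self, map_one]

theorem extOn_of_lt (h : i < j) :
    extOn hi hj f = X.unitsRes (le_inf hi hj) (f ⟨(i, j), h⟩) := by
  rw [extOn, ext_of_lt h]

theorem extOn_symm : extOn hj hi f = (extOn hi hj f)⁻¹ := by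
  rcases lt_trichotomy i j with h | rfl | h
  · rw [extOn, extOn, ext_of_gt h, ext_of_lt h, map_inv, X.unitsRes_res]
  · rw [extOn_self, inv_one]
  · rw [extOn, extOn, ext_of_gt h, ext_of_lt h, map_inv, X.unitsRes_res, inv_inv]

theorem extOn_res {W' : Opens X.carrier} (h : W' ≤ W) :
    X.unitsRes h (extOn hi hj f) = extOn (h.trans hi) (h.trans hj) f := by
  rw [extOn, extOn, X.unitsRes_res]

variable {f}

theorem extOn_mul_of_lt (hf : f ∈ 𝒰.Z1) (hij : i < j) (hjk : j < k) :
    extOn hi hj f * extOn hj hk f = extOn hi hk f := by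
  have h := congrArg (X.unitsRes (le_inf (le_inf hi hj) hk))
    (congrFun hf (⟨(i, j, k), hij, hjk⟩ : 𝒰.Triples))
  simp only [d1p, d1m, MonoidHom.coe_mk, OneHom.coe_mk, map_mul, X.unitsRes_res] at h
  rw [extOn_of_lt hi hj f hij, extOn_of_lt hj hk f hjk, extOn_of_lt hi hk f (hij.trans hjk),
    mul_comm]
  exact h

theorem extOn_mul (hf : f ∈ 𝒰.Z1) : extOn hi hj f * extOn hj hk f = extOn hi hk f := by
  rcases lt_trichotomy i j with hij | rfl | hij
  · rcases lt_trichotomy j k with hjk | rfl | hjk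
    · exact extOn_mul_of_lt hi hj hk hf hij hjk
    · rw [extOn_self, mul_one]
    · rw [extOn_symm hk hj, mul_inv_eq_iff_eq_mul]
      rcases lt_trichotomy i k with hik | rfl | hik
      · exact (extOn_mul_of_lt hi hk hj hf hik hjk).symm
      · rw [extOn_self, one_mul]
      · rw [extOn_symm hk hi, eq_inv_mul_iff_mul_eq]
        exact extOn_mul_of_lt hk hi hj hf hik hij
  · rw [extOn_self, one_mul]
  · rw [extOn_symm hj hi, inv_mul_eq_iff_eq_mul]
    rcases lt_trichotomy i k with hik | rfl | hik
    · exact (extOn_mul_of_lt hj hi hk hf hij hik).symm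
    · rw [extOn_self, mul_one]
    · rw [extOn_symm hk hi, eq_mul_inv_iff_mul_eq]
      rcases lt_trichotomy j k with hjk | rfl | hjk
      · exact extOn_mul_of_lt hj hk hi hf hjk hik
      · rw [extOn_self, one_mul]
      · rw [extOn_symm hk hj, inv_mul_eq_iff_eq_mul]
        exact (extOn_mul_of_lt hk hj hi hf hjk hij).symm

end extOn

variable (𝒰 𝒱) in
/-- The data of a refinement: `V_j ⊆ U_{σ(j)}`. -/
structure Refinement where
  σ : 𝒱.ι → 𝒰.ι
  le : ∀ j, 𝒱.set j ≤ 𝒰.set (σ j)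

namespace Refinement

variable {𝒲 : OpenCover X} (σ τ : Refinement 𝒰 𝒱)

/-- The map on `C⁰`: `σ(x)_j = x_{σ(j)}`. -/
def onC0 : 𝒰.C0 →* 𝒱.C0 where
  toFun x j := X.unitsRes (σ.le j) (x (σ.σ j))
  map_one' := funext fun _ => map_one _
  map_mul' _ _ := funext fun _ => map_mul _ _ _

/-- The map on `C¹`: `σ(x)_{jk} = x_{σ(j)σ(k)}`, with the convention that `x` is extended to all
pairs of indices as an alternating cochain. -/
def onC1 : 𝒰.C1 →* 𝒱.C1 where
  toFun x p := X.unitsRes (inf_le_inf (σ.le p.1.1) (σ.le p.1.2))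
    (𝒰.ext (σ.σ p.1.1) (σ.σ p.1.2) x)
  map_one' := funext fun _ => by rw [map_one, map_one]; rfl
  map_mul' _ _ := funext fun _ => by rw [map_mul, map_mul]; rfl

theorem onC1_apply (x : 𝒰.C1) (p : 𝒱.Pairs) : σ.onC1 x p =
    extOn (inf_le_left.trans (σ.le p.1.1)) (inf_le_right.trans (σ.le p.1.2)) x := rfl

theorem onC1_mem {x : 𝒰.C1} (hx : x ∈ 𝒰.Z1) : σ.onC1 x ∈ 𝒱.Z1 := by
  refine funext fun t => ?_
  simp only [d1p, d1m, MonoidHom.coe_mk, OneHom.coe_mk, onC1_apply, extOn_res]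
  rw [mul_comm]
  exact extOn_mul _ _ _ hx

theorem extOn_onC1 {W : Opens X.carrier} {j k : 𝒱.ι} (hj : W ≤ 𝒱.set j) (hk : W ≤ 𝒱.set k)
    (x : 𝒰.C1) : extOn hj hk (σ.onC1 x) = extOn (hj.trans (σ.le j)) (hk.trans (σ.le k)) x := by
  rcases lt_trichotomy j k with h | rfl | h
  · rw [extOn_of_lt _ _ _ h, onC1_apply, extOn_res]
  · rw [extOn_self, extOn_self]
  · rw [extOn_symm hk hj, extOn_of_lt _ _ _ h, onC1_apply, extOn_res, ← extOn_symm]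

theorem extOn_d0 {W : Opens X.carrier} {i j : 𝒰.ι} (hi : W ≤ 𝒰.set i) (hj : W ≤ 𝒰.set j)
    (w : 𝒰.C0) : extOn hi hj (𝒰.d0p w) * X.unitsRes hi (w i) =
      extOn hi hj (𝒰.d0m w) * X.unitsRes hj (w j) := by
  have key : ∀ {i j : 𝒰.ι} (hi : W ≤ 𝒰.set i) (hj : W ≤ 𝒰.set j), i < j →
      extOn hi hj (𝒰.d0p w) = X.unitsRes hj (w j) ∧
      extOn hi hj (𝒰.d0m w) = X.unitsRes hi (w i) := by
    intro i j hi hj h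
    rw [extOn_of_lt _ _ _ h, extOn_of_lt _ _ _ h]
    simp [d0p, d0m]
  rcases lt_trichotomy i j with h | rfl | h
  · rw [(key hi hj h).1, (key hi hj h).2, mul_comm]
  · rw [extOn_self, extOn_self]
  · rw [extOn_symm hj hi, extOn_symm hj hi, (key hj hi h).1, (key hj hi h).2, inv_mul_cancel,
      inv_mul_cancel]

/-- The map on cocycles. -/
def onZ1 : 𝒰.Z1 →* 𝒱.Z1 :=
  (σ.onC1.comp 𝒰.Z1.subtype).codRestrict 𝒱.Z1 fun x => σ.onC1_mem x.2

/-- The map `Ȟ¹(𝒰, 𝒪_X^*) → Ȟ¹(𝒱, 𝒪_X^*)` induced by a refinement. -/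
def onH1 : 𝒰.H1 →* 𝒱.H1 :=
  Con.lift _ ((Con.mk' _).comp σ.onZ1) (by
    intro x y h
    obtain ⟨w, h⟩ := (pairCon_iff _ _ _ x y).1 h
    refine (Con.eq _).2 ((pairCon_iff _ _ _ _ _).2 ⟨σ.onC0 w, ?_⟩)
    change σ.onC1 x * 𝒱.d0m (σ.onC0 w) = σ.onC1 y * 𝒱.d0p (σ.onC0 w)
    funext p
    have e := extOn_d0 (inf_le_left.trans (σ.le p.1.1) : 𝒱.inter₂ p.1.1 p.1.2 ≤ _)
      (inf_le_right.trans (σ.le p.1.2)) w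
    have e' := congrFun (congrArg σ.onC1 h) p
    rw [map_mul, map_mul, Pi.mul_apply, Pi.mul_apply, onC1_apply σ (𝒰.d0m w),
      onC1_apply σ (𝒰.d0p w)] at e'
    have a1 : 𝒱.d0m (σ.onC0 w) p =
        X.unitsRes (inf_le_left.trans (σ.le p.1.1)) (w (σ.σ p.1.1)) := by simp [d0m, onC0]
    have a2 : 𝒱.d0p (σ.onC0 w) p =
        X.unitsRes (inf_le_right.trans (σ.le p.1.2)) (w (σ.σ p.1.2)) := by simp [d0p, onC0]
    rw [Pi.mul_apply, Pi.mul_apply, a1, a2]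
    refine mul_right_cancel (b := extOn (inf_le_left.trans (σ.le p.1.1))
      (inf_le_right.trans (σ.le p.1.2)) (𝒰.d0m w)) ?_
    rw [mul_right_comm, e', mul_assoc, e, mul_assoc, mul_comm (X.unitsRes _ _)])

theorem onH1_mk (x : 𝒰.Z1) :
    σ.onH1 (x : 𝒰.H1) = ((σ.onZ1 x : 𝒱.Z1) : 𝒱.H1) := rfl

theorem onH1_eq : σ.onH1 = τ.onH1 := by
  refine MonoidHom.ext fun z => ?_
  induction z using Con.induction_on with
  | H x =>
    rw [onH1_mk, onH1_mk]
    refine (Con.eq _).2 ((pairCon_iff _ _ _ _ _).2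
      ⟨fun j => extOn (τ.le j) (σ.le j) x.1, ?_⟩)
    change σ.onC1 x * _ = τ.onC1 x * _
    funext p
    simp only [d0p, d0m, MonoidHom.coe_mk, OneHom.coe_mk, Pi.mul_apply, onC1_apply, extOn_res]
    rw [mul_comm, extOn_mul _ _ _ x.2, extOn_mul _ _ _ x.2]

variable (𝒰) in
/-- The identity refinement. -/
protected def id : Refinement 𝒰 𝒰 := ⟨fun i => i, fun _ => le_rfl⟩

/-- Composition of refinements. -/
protected def comp (τ : Refinement 𝒱 𝒲) : Refinement 𝒰 𝒲 :=
  ⟨fun k => σ.σ (τ.σ k), fun k => (τ.le k).trans (σ.le _)⟩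

theorem onH1_id (z : 𝒰.H1) : (Refinement.id 𝒰).onH1 z = z := by
  induction z using Con.induction_on with
  | H x =>
    rw [onH1_mk]
    congr 1
    refine Subtype.ext (funext fun p => ?_)
    change (Refinement.id 𝒰).onC1 x.1 p = _
    rw [onC1_apply]
    exact (extOn_of_lt _ _ _ p.2).trans (X.unitsRes_self _ _)

theorem onH1_comp (τ : Refinement 𝒱 𝒲) (z : 𝒰.H1) :
    (σ.comp τ).onH1 z = τ.onH1 (σ.onH1 z) := by
  induction z using Con.induction_on with
  | H x =>
    rw [onH1_mk, onH1_mk, onH1_mk]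
    congr 1
    refine Subtype.ext (funext fun p => ?_)
    change (σ.comp τ).onC1 x.1 p = τ.onC1 (σ.onC1 x.1) p
    rw [onC1_apply, onC1_apply, extOn_onC1]
    rfl

end Refinement

/-- Coverings are preordered by refinement: `𝒰 ≤ 𝒱` if `𝒱` refines `𝒰`. -/
instance : Preorder (OpenCover X) where
  le 𝒰 𝒱 := Nonempty (Refinement 𝒰 𝒱)
  le_refl 𝒰 := ⟨Refinement.id 𝒰⟩
  le_trans _ _ _ := fun ⟨σ⟩ ⟨τ⟩ => ⟨σ.comp τ⟩

instance : Nonempty (OpenCover X) :=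
  ⟨{ ι := PUnit, set := fun _ => ⊤, exists_mem := fun _ => ⟨PUnit.unit, trivial⟩ }⟩

instance : IsDirectedOrder (OpenCover X) where
  directed 𝒰 𝒱 := ⟨{ ι := 𝒰.ι ×ₗ 𝒱.ι
                     set := fun p => 𝒰.set (ofLex p).1 ⊓ 𝒱.set (ofLex p).2
                     exists_mem := fun x => by
                      obtain ⟨i, hi⟩ := 𝒰.exists_mem x
                      obtain ⟨j, hj⟩ := 𝒱.exists_mem x
                      exact ⟨toLex (i, j), hi, hj⟩ },
    ⟨⟨fun p => (ofLex p).1, fun _ => inf_le_left⟩⟩,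
    ⟨⟨fun p => (ofLex p).2, fun _ => inf_le_right⟩⟩⟩

/-- The canonical map `Ȟ¹(𝒰, 𝒪_X^*) → Ȟ¹(𝒱, 𝒪_X^*)` if `𝒱` refines `𝒰`; it does not depend on the
choice of a refinement map. -/
noncomputable def transition (𝒰 𝒱 : OpenCover X) (h : 𝒰 ≤ 𝒱) : 𝒰.H1 →* 𝒱.H1 :=
  (Classical.choice h).onH1

theorem transition_eq {𝒰 𝒱 : OpenCover X} (h : 𝒰 ≤ 𝒱) (σ : Refinement 𝒰 𝒱) :
    transition 𝒰 𝒱 h = σ.onH1 := Refinement.onH1_eq _ _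

instance : DirectedSystem (fun 𝒰 : OpenCover X => 𝒰.H1) (transition · · ·) where
  map_self 𝒰 z := by
    rw [transition_eq le_rfl (Refinement.id 𝒰), Refinement.onH1_id]
  map_map _ _ _ h h' z := by
    obtain ⟨σ⟩ := h
    obtain ⟨τ⟩ := h'
    rw [transition_eq _ σ, transition_eq _ τ, transition_eq _ (σ.comp τ), Refinement.onH1_comp]

end OpenCover

variable (X) in
/-- `Ȟ¹(X, 𝒪_X^*)`: the colimit of the groups `Ȟ¹(𝒰, 𝒪_X^*)` over the open coverings of `X`. -/
abbrev CechH1 : Type (u + 1) :=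
  DirectLimit (fun 𝒰 : OpenCover X => 𝒰.H1) OpenCover.transition

/-- The class in `Ȟ¹(X, 𝒪_X^*)` of a cocycle for an open covering. -/
noncomputable def OpenCover.cechClass (𝒰 : OpenCover X) (f : 𝒰.Z1) : CechH1 X :=
  Quotient.mk _ (Sigma.mk (β := fun 𝒰 : OpenCover X => 𝒰.H1) 𝒰 (f : 𝒰.H1))

end Cech

end SemiringGeometry

/-!
Choose isomorphisms `𝒪_X|_{U_i} ≅ L|_{U_i}` over the members of a covering; the images `e_i` of `1`
form a frame of `L`, and the units `f_ij` with `e_i = f_ij e_j` form a `1`-cocycle. Another frame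
over the same covering has the form `w_i e_i`, which changes the cocycle by the coboundary of `w`,
and every coboundary arises this way. A cocycle determines the sheaf up to isomorphism, because a
frame identifies `L` with the sheaf of families `s_i ∈ 𝒪_X(V ∩ U_i)` such that `s_i f_ij = s_j`;
conversely, for every cocycle `f` this sheaf is invertible with cocycle `f`. Thus the isomorphism
classes are in bijection with `Ȟ¹(X, 𝒪_X^*)`. As `e_i ⊗ e'_i` is a frame of `L ⊗ M` with the product
cocycle, the bijection turns the tensor product into the product, so the group laws in `Pic(X)` come
from those in `Ȟ¹(X, 𝒪_X^*)`.
-/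

namespace SemiringGeometry

variable {X : SemiringedSpace.{u}}

/-! ### Gluing over a covering -/

namespace SemimoduleSheaf

variable (F : SemimoduleSheaf X) {V : Opens X.carrier}

theorem eq_of_cover_eq {κ : Sort*} {U : κ → Opens X.carrier} (hV : V ≤ ⨆ k, U k) {s t : F.obj V}
    (h : ∀ k, F.res (inf_le_left : V ⊓ U k ≤ V) s = F.res inf_le_left t) : s = t :=
  F.eq_of_locally_eq s t fun x hx => by
    obtain ⟨k, hk⟩ := Opens.mem_iSup.1 (hV hx)
    exact ⟨V ⊓ U k, inf_le_left, ⟨hx, hk⟩, h k⟩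

theorem exists_glue_of_le {κ : Type u} {U : κ → Opens X.carrier} (hV : V ≤ ⨆ k, U k)
    (s : ∀ k, F.obj (U k))
    (hs : ∀ (k l : κ) (W : Opens X.carrier) (hk : W ≤ U k) (hl : W ≤ U l),
      F.res hk (s k) = F.res hl (s l)) :
    ∃ t : F.obj V, ∀ (k : κ) (W : Opens X.carrier) (h : W ≤ V) (hk : W ≤ U k),
      F.res h t = F.res hk (s k) := by
  obtain ⟨t, ht⟩ := F.exists_glue U s fun k l => hs k l _ _ _
  exact ⟨F.res hV t, fun k W h hk => by rw [← ht k, F.res_res, F.res_res]⟩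

end SemimoduleSheaf

/-! ### Generators -/

namespace SemimodulePresheaf

variable {L M : SemimodulePresheaf X} {U V W : Opens X.carrier}

/-- A section `e` of `L` over `U` is a generator if `a ↦ a • e|_V` is a bijection `𝒪_X(V) → L(V)`
for all `V ⊆ U`. Generators over `U` correspond to isomorphisms `𝒪_X|_U ≅ L|_U`, the generator being
the image of `1`. -/
def IsGenerator (L : SemimodulePresheaf X) {U : Opens X.carrier} (e : L.obj U) : Prop :=
  ∀ (V : Opens X.carrier) (h : V ≤ U), Function.Bijective fun a : X.sec V => a • L.res h e

namespace IsGenerator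

variable {e e' : L.obj U}

theorem res (he : L.IsGenerator e) (h : V ≤ U) : L.IsGenerator (L.res h e) := fun W hW => by
  simpa only [L.res_res] using he W (hW.trans h)

theorem smul_res_injective (he : L.IsGenerator e) (h : V ≤ U) {a b : X.sec V}
    (hab : a • L.res h e = b • L.res h e) : a = b :=
  (he V h).1 hab

/-- The coordinate of sections over `V ⊆ U` with respect to a generator over `U`. -/
noncomputable def coord (he : L.IsGenerator e) (h : V ≤ U) : L.obj V ≃ₗ[X.sec V] X.sec V :=
  (LinearEquiv.ofBijective (LinearMap.toSpanSingleton (X.sec V) (L.obj V) (L.res h e))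
    (he V h)).symm

theorem coord_symm_apply (he : L.IsGenerator e) (h : V ≤ U) (a : X.sec V) :
    (he.coord h).symm a = a • L.res h e := rfl

theorem coord_smul_res (he : L.IsGenerator e) (h : V ≤ U) (s : L.obj V) :
    he.coord h s • L.res h e = s := (he.coord h).symm_apply_apply s

theorem coord_res (he : L.IsGenerator e) (h : V ≤ U) (h' : W ≤ V) (s : L.obj V) :
    he.coord (h'.trans h) (L.res h' s) = X.res h' (he.coord h s) :=
  he.smul_res_injective (h'.trans h) <| by
    rw [coord_smul_res, ← L.res_res h h', ← LinearMap.map_smulₛₗ, coord_smul_res]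

/-- The unit `a` with `e = a • e'`, for generators `e` and `e'` over the same open set. -/
noncomputable def ratio (he : L.IsGenerator e) (he' : L.IsGenerator e') : X.units U where
  val := he'.coord le_rfl e
  inv := he.coord le_rfl e'
  val_inv := he'.smul_res_injective le_rfl <| by
    rw [mul_comm, mul_smul, coord_smul_res, one_smul]
    simpa only [L.res_self] using he.coord_smul_res le_rfl e'
  inv_val := he.smul_res_injective le_rfl <| by
    rw [mul_comm, mul_smul, coord_smul_res, one_smul]
    simpa only [L.res_self] using he'.coord_smul_res le_rfl e

theorem ratio_smul (he : L.IsGenerator e) (he' : L.IsGenerator e') :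
    (he.ratio he' : X.sec U) • e' = e := by
  have h := he'.coord_smul_res le_rfl e
  rw [L.res_self] at h
  exact h

theorem ratio_eq_of_smul_eq (he : L.IsGenerator e) (he' : L.IsGenerator e') {a : X.units U}
    (h : (a : X.sec U) • e' = e) : he.ratio he' = a :=
  Units.ext <| he'.smul_res_injective le_rfl <| by
    rw [L.res_self, ratio_smul, h]

theorem unit_smul (he : L.IsGenerator e) (w : X.units U) :
    L.IsGenerator ((w : X.sec U) • e) := fun V h => by
  have hcomp : (fun a : X.sec V => a • L.res h ((w : X.sec U) • e)) =
      (fun a : X.sec V => a • L.res h e) ∘ fun a => a * (X.unitsRes h w : X.sec V) :=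
    funext fun a => by
      rw [LinearMap.map_smulₛₗ, smul_smul, Function.comp_apply, X.coe_unitsRes]
  rw [hcomp]
  exact (he V h).comp (Units.mulRight_bijective _)

theorem map {N : Opens X.carrier} (he : L.IsGenerator e) (α : IsoOver N L M) (hU : U ≤ N) :
    M.IsGenerator (α.equiv U hU e) := fun V h => by
  have hcomp : (fun a : X.sec V => a • M.res h (α.equiv U hU e)) =
      α.equiv V (h.trans hU) ∘ fun a : X.sec V => a • L.res h e :=
    funext fun a => by rw [← α.naturality hU h, ← LinearEquiv.map_smul, Function.comp_apply]
  rw [hcomp]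
  exact (α.equiv V (h.trans hU)).bijective.comp (he V h)

/-- The isomorphism `𝒪_X|_U ≅ L|_U` sending `1` to a given generator. -/
noncomputable def isoOver (he : L.IsGenerator e) :
    IsoOver U (structureSheaf X).toSemimodulePresheaf L where
  equiv _ h := (he.coord h).symm
  naturality hV h s := by
    rw [coord_symm_apply, coord_symm_apply, LinearMap.map_smulₛₗ, L.res_res]
    rfl

theorem isoOver_one (he : L.IsGenerator e) :
    he.isoOver.equiv U le_rfl (1 : X.sec U) = e := by
  refine (he.coord_symm_apply le_rfl 1).trans ?_
  rw [one_smul, L.res_self]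

end IsGenerator

end SemimodulePresheaf

theorem isGenerator_one (U : Opens X.carrier) :
    (structureSheaf X).IsGenerator (1 : X.sec U) := fun V h => by
  have hid : (fun a : X.sec V => a • (structureSheaf X).res h (1 : X.sec U)) = id :=
    funext fun a => (congrArg (a * ·) (map_one (X.res h))).trans (mul_one a)
  rw [hid]
  exact Function.bijective_id

/-- The bilinear map sending `s ∈ L(U)` and `t ∈ M(U)` to the section `s ⊗ t` of the sheaf
`L ⊗ M`. -/
noncomputable def tensorSection (L M : SemimoduleSheaf X) (U : Opens X.carrier) :
    L.obj U →ₗ[X.sec U] M.obj U →ₗ[X.sec U] (tensorSheaf L M).obj U :=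
  (TensorProduct.mk (X.sec U) (L.obj U) (M.obj U)).compr₂
    ((tensorPresheaf L.toSemimodulePresheaf M.toSemimodulePresheaf).toSheafify U)

section TensorSection

variable {L M : SemimoduleSheaf X} {U V : Opens X.carrier}

theorem res_tensorSection (h : V ≤ U) (s : L.obj U) (t : M.obj U) :
    (tensorSheaf L M).res h (tensorSection L M U s t) =
      tensorSection L M V (L.res h s) (M.res h t) :=
  Subtype.ext <| funext fun x =>
    (SemimodulePresheaf.germ_res
      (P := tensorPresheaf L.toSemimodulePresheaf M.toSemimodulePresheaf) h x.2 (s ⊗ₜ t)).symm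

theorem tensorSection_smul_smul (a b : X.sec U) (s : L.obj U) (t : M.obj U) :
    tensorSection L M U (a • s) (b • t) = (a * b) • tensorSection L M U s t := by
  rw [LinearMap.map_smul₂, map_smul, smul_smul]

theorem SemimodulePresheaf.IsGenerator.tensor {s : L.obj U} {t : M.obj U} (hs : L.IsGenerator s)
    (ht : M.IsGenerator t) : (tensorSheaf L M).IsGenerator (tensorSection L M U s t) := by
  have himage : (hs.isoOver.tensor ht.isoOver).sheafify.equiv U le_rfl (1 : X.sec U) =
      tensorSection L M U s t :=
    congrArg₂ (fun s t => tensorSection L M U s t) hs.isoOver_one ht.isoOver_one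
  rw [← himage]
  exact (isGenerator_one U).map _ le_rfl

end TensorSection

/-! ### Frames and their cocycles -/

namespace OpenCover

variable {𝒰 𝒱 : OpenCover X}

theorem le_iSup_inf_set (𝒰 : OpenCover X) (V : Opens X.carrier) : V ≤ ⨆ i, V ⊓ 𝒰.set i :=
  fun x hx => by
    obtain ⟨i, hi⟩ := 𝒰.exists_mem x
    exact Opens.mem_iSup.2 ⟨i, hx, hi⟩

theorem mem_Z1_of_extOn_mul {f : 𝒰.C1}
    (hf : ∀ (i j k : 𝒰.ι) (W : Opens X.carrier) (hi : W ≤ 𝒰.set i) (hj : W ≤ 𝒰.set j)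
      (hk : W ≤ 𝒰.set k), extOn hi hj f * extOn hj hk f = extOn hi hk f) : f ∈ 𝒰.Z1 := by
  refine funext fun ⟨⟨i, j, k⟩, hij, hjk⟩ => ?_
  have h := hf i j k (𝒰.inter₃ i j k) (inf_le_left.trans inf_le_left)
    (inf_le_left.trans inf_le_right) inf_le_right
  rw [extOn_of_lt _ _ _ hij, extOn_of_lt _ _ _ hjk, extOn_of_lt _ _ _ (hij.trans hjk),
    mul_comm] at h
  exact h

/-- A frame of `L` over the covering `𝒰`: a generator `e_i` of `L` over each member `U_i`. -/
structure Frame (𝒰 : OpenCover X) (L : SemimodulePresheaf X) where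
  sec : ∀ i, L.obj (𝒰.set i)
  isGenerator : ∀ i, L.IsGenerator (sec i)

namespace Frame

section Cocycle

variable {L M : SemimodulePresheaf X} (F G : 𝒰.Frame L)

/-- The transition functions of a frame: the units `f_ij` with `e_i = f_ij e_j` over `U_ij`. -/
noncomputable def transition : 𝒰.C1 := fun p =>
  ((F.isGenerator p.1.1).res inf_le_left).ratio ((F.isGenerator p.1.2).res inf_le_right)

theorem transition_smul (p : 𝒰.Pairs) :
    (F.transition p : X.sec (𝒰.inter₂ p.1.1 p.1.2)) • L.res inf_le_right (F.sec p.1.2) =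
      L.res inf_le_left (F.sec p.1.1) :=
  SemimodulePresheaf.IsGenerator.ratio_smul _ _

theorem extOn_transition_smul {i j : 𝒰.ι} {W : Opens X.carrier} (hi : W ≤ 𝒰.set i)
    (hj : W ≤ 𝒰.set j) :
    (extOn hi hj F.transition : X.sec W) • L.res hj (F.sec j) = L.res hi (F.sec i) := by
  have of_lt : ∀ {i j : 𝒰.ι} (hi : W ≤ 𝒰.set i) (hj : W ≤ 𝒰.set j), i < j →
      (extOn hi hj F.transition : X.sec W) • L.res hj (F.sec j) = L.res hi (F.sec i) := by
    intro i j hi hj hij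
    have h := congrArg (L.res (le_inf hi hj)) (F.transition_smul ⟨(i, j), hij⟩)
    rwa [LinearMap.map_smulₛₗ, L.res_res, L.res_res, ← X.coe_unitsRes,
      ← extOn_of_lt hi hj] at h
  rcases lt_trichotomy i j with hij | rfl | hji
  · exact of_lt hi hj hij
  · rw [extOn_self, Units.val_one, one_smul]
  · rw [← of_lt hj hi hji, extOn_symm hj hi, smul_smul, Units.inv_mul, one_smul]

theorem transition_mem_Z1 : F.transition ∈ 𝒰.Z1 :=
  mem_Z1_of_extOn_mul fun _ _ k _ hi hj hk =>
    Units.ext <| (F.isGenerator k).smul_res_injective hk <| by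
      rw [Units.val_mul, mul_smul, extOn_transition_smul, extOn_transition_smul,
        extOn_transition_smul]

/-- The transition functions of a frame as a cocycle. -/
noncomputable def cocycle : 𝒰.Z1 := ⟨F.transition, F.transition_mem_Z1⟩

variable {F} in
theorem cocycle_eq_of_smul_eq {f : 𝒰.Z1}
    (hf : ∀ p : 𝒰.Pairs,
      (f.1 p : X.sec (𝒰.inter₂ p.1.1 p.1.2)) • L.res inf_le_right (F.sec p.1.2) =
        L.res inf_le_left (F.sec p.1.1)) : F.cocycle = f :=
  Subtype.ext <| funext fun p => SemimodulePresheaf.IsGenerator.ratio_eq_of_smul_eq _ _ (hf p)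

/-- The restriction of a frame to a refinement. -/
def refine (σ : Refinement 𝒰 𝒱) : 𝒱.Frame L where
  sec j := L.res (σ.le j) (F.sec (σ.σ j))
  isGenerator j := (F.isGenerator (σ.σ j)).res (σ.le j)

theorem cocycle_refine (σ : Refinement 𝒰 𝒱) : (F.refine σ).cocycle = σ.onZ1 F.cocycle :=
  cocycle_eq_of_smul_eq fun p => by
    simp only [refine, L.res_res]
    exact F.extOn_transition_smul _ _

/-- The image of a frame under an isomorphism. -/
def map (α : IsoOver ⊤ L M) : 𝒰.Frame M where
  sec i := α.equiv (𝒰.set i) le_top (F.sec i)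
  isGenerator i := (F.isGenerator i).map α le_top

theorem cocycle_map (α : IsoOver ⊤ L M) : (F.map α).cocycle = F.cocycle :=
  cocycle_eq_of_smul_eq fun p => by
    simp only [map, ← α.naturality le_top, ← F.transition_smul, LinearEquiv.map_smul]
    rfl

/-- The frame `w_i e_i`, for units `w_i ∈ 𝒪_X^*(U_i)`. -/
def unitSMul (w : 𝒰.C0) : 𝒰.Frame L where
  sec i := (w i : X.sec (𝒰.set i)) • F.sec i
  isGenerator i := (F.isGenerator i).unit_smul (w i)

theorem transition_unitSMul (w : 𝒰.C0) :
    (F.unitSMul w).transition * 𝒰.d0p w = F.transition * 𝒰.d0m w := by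
  refine funext fun p => Units.ext <| (F.isGenerator p.1.2).smul_res_injective inf_le_right ?_
  have h := (F.unitSMul w).transition_smul p
  simp only [unitSMul, LinearMap.map_smulₛₗ, ← F.transition_smul, smul_smul] at h
  rw [mul_comm F.transition]
  exact h

theorem exists_eq_unitSMul : ∃ w : 𝒰.C0, G = F.unitSMul w := by
  refine ⟨fun i => (G.isGenerator i).ratio (F.isGenerator i), ?_⟩
  simp only [unitSMul, SemimodulePresheaf.IsGenerator.ratio_smul]

end Cocycle

/-- The tensor product of two frames. -/
noncomputable def tensor {L M : SemimoduleSheaf X} (F : 𝒰.Frame L.toSemimodulePresheaf)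
    (G : 𝒰.Frame M.toSemimodulePresheaf) : 𝒰.Frame (tensorSheaf L M).toSemimodulePresheaf where
  sec i := tensorSection L M (𝒰.set i) (F.sec i) (G.sec i)
  isGenerator i := (F.isGenerator i).tensor (G.isGenerator i)

theorem cocycle_tensor {L M : SemimoduleSheaf X} (F : 𝒰.Frame L.toSemimodulePresheaf)
    (G : 𝒰.Frame M.toSemimodulePresheaf) : (F.tensor G).cocycle = F.cocycle * G.cocycle :=
  cocycle_eq_of_smul_eq fun p => by
    simp only [tensor, res_tensorSection, ← F.transition_smul, ← G.transition_smul,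
      tensorSection_smul_smul]
    rfl

/-- The frame of `𝒪_X` given by the sections `1`. -/
def one (𝒰 : OpenCover X) : 𝒰.Frame (structureSheaf X).toSemimodulePresheaf where
  sec i := (1 : X.sec (𝒰.set i))
  isGenerator i := isGenerator_one (𝒰.set i)

theorem cocycle_one : (one 𝒰).cocycle = 1 :=
  cocycle_eq_of_smul_eq fun _ =>
    (one_smul _ _).trans ((map_one (X.res _)).trans (map_one (X.res _)).symm)

/-- The frame consisting of the images of `1` under isomorphisms `𝒪_X|_{U_i} ≅ L|_{U_i}`. -/
def ofIso {L : SemimodulePresheaf X}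
    (φ : ∀ i, IsoOver (𝒰.set i) (structureSheaf X).toSemimodulePresheaf L) : 𝒰.Frame L where
  sec i := (φ i).equiv (𝒰.set i) le_rfl (1 : X.sec (𝒰.set i))
  isGenerator i := (isGenerator_one (𝒰.set i)).map (φ i) le_rfl

end Frame

end OpenCover

theorem IsInvertible.exists_frame {L : SemimoduleSheaf X} (hL : IsInvertible L) :
    ∃ 𝒰 : OpenCover X, Nonempty (𝒰.Frame L.toSemimodulePresheaf) := by
  choose U hU φ using hL
  let _ : LinearOrder X.carrier := IsWellOrder.linearOrder WellOrderingRel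
  let 𝒰 : OpenCover X := ⟨X.carrier, U, fun x => ⟨x, hU x⟩⟩
  exact ⟨𝒰, ⟨.ofIso fun x => (φ x).some⟩⟩

/-! ### The sheaf glued from a cocycle -/

namespace OpenCover

variable {𝒰 : OpenCover X}

/-- Sections over `V` of the sheaf glued from a cochain `f`: the families of `s_i ∈ 𝒪_X(V ∩ U_i)`
with `s_i f_ij = s_j`. This relation is required over all open subsets of `V ∩ U_i ∩ U_j`, so that
it can be used without restricting from `V ∩ U_i ∩ U_j` first. -/
def twistSections (f : 𝒰.C1) (V : Opens X.carrier) :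
    AddSubmonoid (∀ i, X.sec (V ⊓ 𝒰.set i)) where
  carrier := {s | ∀ (i j : 𝒰.ι) (W : Opens X.carrier) (hi : W ≤ V ⊓ 𝒰.set i)
    (hj : W ≤ V ⊓ 𝒰.set j), X.res hi (s i) *
      extOn (hi.trans inf_le_right) (hj.trans inf_le_right) f = X.res hj (s j)}
  add_mem' hs ht i j W hi hj := by
    rw [Pi.add_apply, Pi.add_apply, map_add, map_add, add_mul, hs i j W hi hj, ht i j W hi hj]
  zero_mem' i j W hi hj := by
    rw [Pi.zero_apply, Pi.zero_apply, map_zero, map_zero, zero_mul]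

section Twist

variable {f : 𝒰.C1} {V W : Opens X.carrier}

instance : SMul (X.sec V) (twistSections f V) where
  smul a s := ⟨fun i => X.res inf_le_left a * s.1 i, fun i j W hi hj => by
    rw [map_mul, map_mul, X.res_res, X.res_res, mul_assoc, s.2 i j W hi hj]⟩

theorem twistSections_smul_apply (a : X.sec V) (s : twistSections f V) (i : 𝒰.ι) :
    (a • s).1 i = X.res inf_le_left a * s.1 i := rfl

theorem twistSections_ext {s t : twistSections f V} (h : ∀ i, s.1 i = t.1 i) : s = t :=
  Subtype.ext (funext h)

instance : Module (X.sec V) (twistSections f V) where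
  one_smul s := twistSections_ext fun i => by rw [twistSections_smul_apply, map_one, one_mul]
  mul_smul a b s := twistSections_ext fun i => by
    simp only [twistSections_smul_apply, map_mul, mul_assoc]
  smul_zero a := twistSections_ext fun i => mul_zero _
  smul_add a s t := twistSections_ext fun i => mul_add _ _ _
  add_smul a b s := twistSections_ext fun i => by
    rw [twistSections_smul_apply, map_add, add_mul]
    rfl
  zero_smul s := twistSections_ext fun i => by
    rw [twistSections_smul_apply, map_zero, zero_mul]
    rfl

/-- The presheaf `V ↦ twistSections f V`, with componentwise restriction. -/
def twistPresheaf (f : 𝒰.C1) : SemimodulePresheaf X where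
  obj V := twistSections f V
  res h :=
    { toFun := fun s => ⟨fun i => X.res (inf_le_inf_right _ h) (s.1 i), fun i j N hi hj => by
        rw [X.res_res, X.res_res]
        exact s.2 i j N _ _⟩
      map_add' := fun s t => twistSections_ext fun i => map_add _ _ _
      map_smul' := fun a s => twistSections_ext fun i => by
        simp only [twistSections_smul_apply, map_mul, X.res_res] }
  res_self h s := twistSections_ext fun i => X.res_self _ _
  res_res h h' s := twistSections_ext fun i => X.res_res _ _ _

theorem twistPresheaf_res_apply (h : W ≤ V) (s : twistSections f V) (i : 𝒰.ι) :
    ((twistPresheaf f).res h s : twistSections f W).1 i = X.res (inf_le_inf_right _ h) (s.1 i) :=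
  rfl

theorem mem_twistSections_of_cover {κ : Type u} {U : κ → Opens X.carrier} (hV : V ≤ ⨆ k, U k)
    (s : ∀ k, twistSections f (U k)) {t : ∀ i, X.sec (V ⊓ 𝒰.set i)}
    (ht : ∀ (i : 𝒰.ι) (k : κ) (W : Opens X.carrier) (h : W ≤ V ⊓ 𝒰.set i)
      (hk : W ≤ U k ⊓ 𝒰.set i), X.res h (t i) = X.res hk ((s k).1 i)) :
    t ∈ twistSections f V := fun i j W hi hj => by
  refine (structureSheaf X).eq_of_cover_eq ((hi.trans inf_le_left).trans hV) fun k => ?_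
  have hik : W ⊓ U k ≤ U k ⊓ 𝒰.set i :=
    le_inf inf_le_right (inf_le_left.trans (hi.trans inf_le_right))
  have hjk : W ⊓ U k ≤ U k ⊓ 𝒰.set j :=
    le_inf inf_le_right (inf_le_left.trans (hj.trans inf_le_right))
  change X.res inf_le_left _ = X.res inf_le_left _
  rw [map_mul, X.res_res, X.res_res, ht i k _ _ hik, ht j k _ _ hjk, ← X.coe_unitsRes, extOn_res]
  exact (s k).2 i j _ hik hjk

theorem exists_glue_twistSections {κ : Type u} (U : κ → Opens X.carrier)
    (s : ∀ k, twistSections f (U k))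
    (hs : ∀ k l, (twistPresheaf f).res (inf_le_left : U k ⊓ U l ≤ U k) (s k) =
      (twistPresheaf f).res (inf_le_right : U k ⊓ U l ≤ U l) (s l)) :
    ∃ t : twistSections f (iSup U), ∀ k, (twistPresheaf f).res (le_iSup U k) t = s k := by
  have agree (i : 𝒰.ι) (k l : κ) (W : Opens X.carrier) (hk : W ≤ U k ⊓ 𝒰.set i)
      (hl : W ≤ U l ⊓ 𝒰.set i) : X.res hk ((s k).1 i) = X.res hl ((s l).1 i) := by
    have hW : W ≤ U k ⊓ U l ⊓ 𝒰.set i :=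
      le_inf (le_inf (hk.trans inf_le_left) (hl.trans inf_le_left)) (hk.trans inf_le_right)
    have h := congrArg (X.res hW) (congrFun (congrArg Subtype.val (hs k l)) i)
    rwa [twistPresheaf_res_apply, twistPresheaf_res_apply, X.res_res, X.res_res] at h
  choose t ht using fun i => (structureSheaf X).exists_glue_of_le
    (iSup_inf_eq U (𝒰.set i)).le (fun k => (s k).1 i) (agree i)
  refine ⟨⟨t, mem_twistSections_of_cover le_rfl s ht⟩, fun k => twistSections_ext fun i => ?_⟩
  exact (ht i k _ (inf_le_inf_right _ (le_iSup U k)) le_rfl).trans (X.res_self _ _)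

/-- The sheaf glued from copies of `𝒪_X|_{U_i}` by means of a cochain. -/
def twistSheaf (f : 𝒰.C1) : SemimoduleSheaf X where
  toSemimodulePresheaf := twistPresheaf f
  eq_of_locally_eq s t H := twistSections_ext fun i => X.eq_of_locally_eq _ _ fun x hx => by
    obtain ⟨V, h, hV, hst⟩ := H x hx.1
    exact ⟨V ⊓ 𝒰.set i, inf_le_inf_right _ h, ⟨hV, hx.2⟩,
      congrFun (congrArg Subtype.val hst) i⟩
  exists_glue := exists_glue_twistSections

end Twist

/-- The section over `U_i` of the sheaf glued from a cocycle `f` that has the components `f_ik`; its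
`i`-th component is `1`. -/
def twistGenerator (f : 𝒰.Z1) (i : 𝒰.ι) : twistSections f.1 (𝒰.set i) :=
  ⟨fun k => (𝒰.ext i k f.1 : X.sec (𝒰.set i ⊓ 𝒰.set k)), fun _ _ _ hj hk =>
    congrArg Units.val (extOn_mul (hj.trans inf_le_left) (hj.trans inf_le_right)
      (hk.trans inf_le_right) f.2)⟩

theorem smul_res_twistGenerator_apply (f : 𝒰.Z1) {i : 𝒰.ι} {V : Opens X.carrier}
    (h : V ≤ 𝒰.set i) (a : X.sec V) (k : 𝒰.ι) :
    (a • (twistPresheaf f.1).res h (twistGenerator f i) : twistSections f.1 V).1 k =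
      X.res inf_le_left a *
        (extOn (j := k) (inf_le_left.trans h) inf_le_right f.1 : X.sec (V ⊓ 𝒰.set k)) := rfl

theorem isGenerator_twistGenerator (f : 𝒰.Z1) (i : 𝒰.ι) :
    (twistPresheaf f.1).IsGenerator (twistGenerator f i) := fun V h => by
  have hV : V ≤ V ⊓ 𝒰.set i := le_inf le_rfl h
  refine ⟨fun a b hab => ?_, fun s => ⟨X.res hV (s.1 i), twistSections_ext fun k => ?_⟩⟩
  · have hi : X.res (inf_le_left : V ⊓ 𝒰.set i ≤ V) a = X.res inf_le_left b :=
      (Units.mul_left_inj (extOn (j := i) (inf_le_left.trans h) inf_le_right f.1)).1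
        (congrFun (congrArg Subtype.val hab) i)
    simpa only [X.res_res, X.res_self] using congrArg (X.res hV) hi
  · have hk := s.2 i k (V ⊓ 𝒰.set k) (inf_le_left.trans hV) le_rfl
    rw [X.res_self] at hk
    refine (smul_res_twistGenerator_apply f h _ k).trans ?_
    rw [X.res_res]
    exact hk

/-- The frame of the sheaf glued from a cocycle. -/
def twistFrame (f : 𝒰.Z1) : 𝒰.Frame (twistSheaf f.1).toSemimodulePresheaf where
  sec := twistGenerator f
  isGenerator := isGenerator_twistGenerator f

theorem cocycle_twistFrame (f : 𝒰.Z1) : (twistFrame f).cocycle = f :=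
  Frame.cocycle_eq_of_smul_eq fun p => twistSections_ext fun k => by
    have h := extOn_mul (W := 𝒰.inter₂ p.1.1 p.1.2 ⊓ 𝒰.set k) (inf_le_left.trans inf_le_left)
      (inf_le_left.trans inf_le_right) inf_le_right f.2
    rw [extOn_of_lt _ _ _ p.2] at h
    exact congrArg Units.val h

theorem isInvertible_twistSheaf (f : 𝒰.Z1) : IsInvertible (twistSheaf f.1) := fun x => by
  obtain ⟨i, hi⟩ := 𝒰.exists_mem x
  exact ⟨𝒰.set i, hi, ⟨((twistFrame f).isGenerator i).isoOver⟩⟩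

namespace Frame

theorem coord_mul_extOn_transition {L : SemimodulePresheaf X} (F : 𝒰.Frame L) {i j : 𝒰.ι}
    {W : Opens X.carrier} (hi : W ≤ 𝒰.set i) (hj : W ≤ 𝒰.set j) (s : L.obj W) :
    (F.isGenerator i).coord hi s * extOn hi hj F.transition = (F.isGenerator j).coord hj s :=
  (F.isGenerator j).smul_res_injective hj <| by
    rw [mul_smul, F.extOn_transition_smul, SemimodulePresheaf.IsGenerator.coord_smul_res,
      SemimodulePresheaf.IsGenerator.coord_smul_res]

/-- The coordinates of sections with respect to a frame, as sections of the sheaf glued from the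
transition functions. -/
noncomputable def coords {L : SemimodulePresheaf X} (F : 𝒰.Frame L) (V : Opens X.carrier) :
    L.obj V →ₗ[X.sec V] twistSections F.transition V where
  toFun s := ⟨fun i => (F.isGenerator i).coord inf_le_right (L.res inf_le_left s),
    fun i j W hi hj => by
      simp only [← SemimodulePresheaf.IsGenerator.coord_res, L.res_res]
      exact F.coord_mul_extOn_transition _ _ _⟩
  map_add' s t := twistSections_ext fun i => by
    simp only [map_add]
    rfl
  map_smul' a s := twistSections_ext fun i => by
    simp only [LinearMap.map_smulₛₗ, LinearEquiv.map_smul]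
    rfl

theorem coords_apply {L : SemimodulePresheaf X} (F : 𝒰.Frame L) {V : Opens X.carrier}
    (s : L.obj V) (i : 𝒰.ι) :
    (F.coords V s).1 i = (F.isGenerator i).coord inf_le_right (L.res inf_le_left s) := rfl

variable {L M : SemimoduleSheaf X} (F : 𝒰.Frame L.toSemimodulePresheaf)
  (G : 𝒰.Frame M.toSemimodulePresheaf)

theorem coords_injective (V : Opens X.carrier) : Function.Injective (F.coords V) := by
  refine fun s t h => L.eq_of_cover_eq (U := 𝒰.set)
    ((𝒰.le_iSup_inf_set V).trans (iSup_mono fun _ => inf_le_right)) fun i => ?_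
  have hi := congrFun (congrArg Subtype.val h) i
  exact ((F.isGenerator i).coord inf_le_right).injective hi

theorem coords_surjective (V : Opens X.carrier) : Function.Surjective (F.coords V) := by
  intro a
  obtain ⟨t, ht⟩ := L.exists_glue_of_le (𝒰.le_iSup_inf_set V)
    (fun i => a.1 i • L.res inf_le_right (F.sec i)) fun i j W hi hj => by
      rw [LinearMap.map_smulₛₗ, LinearMap.map_smulₛₗ, L.res_res, L.res_res,
        ← F.extOn_transition_smul _ (hj.trans inf_le_right), smul_smul, a.2 i j W hi hj]
  refine ⟨t, twistSections_ext fun i => ?_⟩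
  rw [coords_apply, ht i _ inf_le_left le_rfl, L.res_self, ← LinearEquiv.eq_symm_apply,
    SemimodulePresheaf.IsGenerator.coord_symm_apply]

/-- A frame identifies a sheaf with the sheaf glued from the transition functions. -/
noncomputable def isoTwist :
    IsoOver ⊤ L.toSemimodulePresheaf (twistSheaf F.transition).toSemimodulePresheaf where
  equiv V _ := LinearEquiv.ofBijective (F.coords V) ⟨F.coords_injective V, F.coords_surjective V⟩
  naturality _ h s := twistSections_ext fun i => by
    have hi := (F.isGenerator i).coord_res inf_le_right (inf_le_inf_right _ h)
      (L.res inf_le_left s)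
    rw [L.res_res] at hi
    change (F.coords _ (L.res h s)).1 i = X.res (inf_le_inf_right _ h) ((F.coords _ s).1 i)
    rw [coords_apply, coords_apply, L.res_res]
    exact hi

end Frame

/-! ### Cohomology classes -/

theorem mk_eq_mk_iff {x y : 𝒰.Z1} :
    (x : 𝒰.H1) = y ↔ ∃ w : 𝒰.C0, (x : 𝒰.C1) * 𝒰.d0m w = y * 𝒰.d0p w :=
  (Con.eq _).trans (pairCon_iff _ _ _ _ _)

namespace Frame

theorem mk_cocycle_eq {L : SemimodulePresheaf X} (F G : 𝒰.Frame L) :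
    (F.cocycle : 𝒰.H1) = G.cocycle := by
  obtain ⟨w, rfl⟩ := F.exists_eq_unitSMul G
  exact mk_eq_mk_iff.2 ⟨w, (F.transition_unitSMul w).symm⟩

theorem exists_cocycle_eq_of_mk_eq {L : SemimodulePresheaf X} (F : 𝒰.Frame L) {g : 𝒰.Z1}
    (h : (F.cocycle : 𝒰.H1) = g) : ∃ G : 𝒰.Frame L, G.cocycle = g := by
  obtain ⟨w, hw⟩ := mk_eq_mk_iff.1 h
  exact ⟨F.unitSMul w, Subtype.ext (mul_right_cancel ((F.transition_unitSMul w).trans hw))⟩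

end Frame

variable {𝒱 : OpenCover X}

theorem cechClass_eq_iff {x : 𝒰.Z1} {y : 𝒱.Z1} : 𝒰.cechClass x = 𝒱.cechClass y ↔
    ∃ (𝒲 : OpenCover X) (σ : Refinement 𝒰 𝒲) (τ : Refinement 𝒱 𝒲),
      (σ.onZ1 x : 𝒲.H1) = τ.onZ1 y := by
  constructor
  · intro h
    obtain ⟨𝒲, ⟨σ⟩, ⟨τ⟩, e⟩ := Quotient.exact h
    rw [transition_eq _ σ, transition_eq _ τ] at e
    exact ⟨𝒲, σ, τ, e⟩
  · rintro ⟨𝒲, σ, τ, e⟩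
    refine Quotient.sound ⟨𝒲, ⟨σ⟩, ⟨τ⟩, ?_⟩
    rw [transition_eq _ σ, transition_eq _ τ]
    exact e

theorem cechClass_mul (x y : 𝒰.Z1) : 𝒰.cechClass (x * y) = 𝒰.cechClass x * 𝒰.cechClass y :=
  (DirectLimit.mul_def (G := fun 𝒰 : OpenCover X => 𝒰.H1) (f := OpenCover.transition) 𝒰
    (x : 𝒰.H1) (y : 𝒰.H1)).symm

theorem cechClass_one (𝒰 : OpenCover X) : 𝒰.cechClass 1 = 1 :=
  (DirectLimit.one_def (G := fun 𝒰 : OpenCover X => 𝒰.H1) (f := OpenCover.transition) 𝒰).symm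

theorem exists_cechClass_eq (z : CechH1 X) :
    ∃ (𝒰 : OpenCover X) (f : 𝒰.Z1), 𝒰.cechClass f = z := by
  obtain ⟨𝒰, y, rfl⟩ := DirectLimit.exists_eq_mk _ z
  obtain ⟨f, rfl⟩ := Con.mk'_surjective y
  exact ⟨𝒰, f, rfl⟩

theorem Frame.equiv_iff_cechClass_eq {L M : InvertibleSheaf X}
    (F : 𝒰.Frame L.1.toSemimodulePresheaf) (G : 𝒱.Frame M.1.toSemimodulePresheaf) :
    L ≈ M ↔ 𝒰.cechClass F.cocycle = 𝒱.cechClass G.cocycle := by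
  constructor
  · rintro ⟨α⟩
    obtain ⟨𝒲, ⟨σ⟩, ⟨τ⟩⟩ := exists_ge_ge 𝒰 𝒱
    refine cechClass_eq_iff.2 ⟨𝒲, σ, τ, ?_⟩
    rw [← F.cocycle_map α, ← cocycle_refine, ← cocycle_refine]
    exact mk_cocycle_eq _ _
  · intro h
    obtain ⟨𝒲, σ, τ, hστ⟩ := cechClass_eq_iff.1 h
    rw [← cocycle_refine, ← cocycle_refine] at hστ
    obtain ⟨F', hF'⟩ := (F.refine σ).exists_cocycle_eq_of_mk_eq hστ
    let T (f : 𝒲.Z1) : InvertibleSheaf X := ⟨twistSheaf f.1, isInvertible_twistSheaf f⟩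
    have hL : L ≈ T F'.cocycle := ⟨F'.isoTwist⟩
    have hM : M ≈ T (G.refine τ).cocycle := ⟨(G.refine τ).isoTwist⟩
    exact Setoid.trans (hF' ▸ hL) (Setoid.symm hM)

end OpenCover

namespace InvertibleSheaf

/-- The class in `Ȟ¹(X, 𝒪_X^*)` of an invertible sheaf: the class of the cocycle of any frame. -/
noncomputable def cechClass (L : InvertibleSheaf X) : CechH1 X :=
  L.2.exists_frame.choose.cechClass L.2.exists_frame.choose_spec.some.cocycle

theorem cechClass_eq {L : InvertibleSheaf X} {𝒰 : OpenCover X}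
    (F : 𝒰.Frame L.1.toSemimodulePresheaf) : L.cechClass = 𝒰.cechClass F.cocycle :=
  (OpenCover.Frame.equiv_iff_cechClass_eq _ F).1 (Setoid.refl L)

theorem equiv_iff_cechClass_eq {L M : InvertibleSheaf X} : L ≈ M ↔ L.cechClass = M.cechClass :=
  OpenCover.Frame.equiv_iff_cechClass_eq _ _

theorem cechClass_surjective : Function.Surjective (cechClass (X := X)) := fun z => by
  obtain ⟨𝒰, f, rfl⟩ := OpenCover.exists_cechClass_eq z
  refine ⟨⟨OpenCover.twistSheaf f.1, OpenCover.isInvertible_twistSheaf f⟩, ?_⟩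
  rw [cechClass_eq (OpenCover.twistFrame f), OpenCover.cocycle_twistFrame]

theorem cechClass_unit : (unit X).cechClass = 1 := by
  obtain ⟨𝒰⟩ : Nonempty (OpenCover X) := inferInstance
  exact (cechClass_eq (L := unit X) (OpenCover.Frame.one 𝒰)).trans
    ((congrArg 𝒰.cechClass OpenCover.Frame.cocycle_one).trans 𝒰.cechClass_one)

theorem cechClass_tensor (L M : InvertibleSheaf X) :
    (L.tensor M).cechClass = L.cechClass * M.cechClass := by
  obtain ⟨𝒰, ⟨F⟩⟩ := L.2.exists_frame
  obtain ⟨𝒱, ⟨G⟩⟩ := M.2.exists_frame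
  obtain ⟨𝒲, ⟨σ⟩, ⟨τ⟩⟩ := exists_ge_ge 𝒰 𝒱
  rw [cechClass_eq (F.refine σ), cechClass_eq (G.refine τ), ← OpenCover.cechClass_mul,
    ← OpenCover.Frame.cocycle_tensor]
  exact cechClass_eq (L := L.tensor M) ((F.refine σ).tensor (G.refine τ))

end InvertibleSheaf

namespace Pic

/-- The bijection `Pic(X) → Ȟ¹(X, 𝒪_X^*)`. -/
noncomputable def equivCechH1 (X : SemiringedSpace.{u}) : Pic X ≃ CechH1 X :=
  Equiv.ofBijective
    (Quotient.lift InvertibleSheaf.cechClass fun _ _ => InvertibleSheaf.equiv_iff_cechClass_eq.1)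
    ⟨fun p q => Quotient.inductionOn₂ p q fun _ _ h =>
      Quotient.sound (InvertibleSheaf.equiv_iff_cechClass_eq.2 h),
    Quotient.lift_surjective _ _ InvertibleSheaf.cechClass_surjective⟩

noncomputable instance : CommGroup (Pic X) := (equivCechH1 X).commGroup

/-- The group isomorphism `Pic(X) ≅ Ȟ¹(X, 𝒪_X^*)`. -/
noncomputable def mulEquivCechH1 (X : SemiringedSpace.{u}) : Pic X ≃* CechH1 X :=
  (equivCechH1 X).mulEquiv

theorem mulEquivCechH1_isoClass (L : InvertibleSheaf X) :
    mulEquivCechH1 X L.isoClass = L.cechClass := rfl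

theorem isoClass_unit : (InvertibleSheaf.unit X).isoClass = 1 :=
  (mulEquivCechH1 X).injective <| by
    rw [mulEquivCechH1_isoClass, InvertibleSheaf.cechClass_unit, map_one]

theorem isoClass_tensor (L M : InvertibleSheaf X) :
    (L.tensor M).isoClass = L.isoClass * M.isoClass :=
  (mulEquivCechH1 X).injective <| by
    rw [map_mul, mulEquivCechH1_isoClass, mulEquivCechH1_isoClass, mulEquivCechH1_isoClass,
      InvertibleSheaf.cechClass_tensor]

end Pic

end SemiringGeometry

open SemiringGeometry in
theorem mainTheorem1_general (X : SemiringedSpace.{u}) :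
    ∃ _ : CommGroup (Pic X),
      (InvertibleSheaf.unit X).isoClass = 1 ∧
      (∀ L M : InvertibleSheaf X, (L.tensor M).isoClass = L.isoClass * M.isoClass) ∧
      ∃ Φ : Pic X ≃* CechH1 X,
        ∀ (L : InvertibleSheaf X) (𝒰 : OpenCover X)
          (φ : ∀ i, IsoOver (𝒰.set i) (structureSheaf X).toSemimodulePresheaf
            L.1.toSemimodulePresheaf),
          ∃ f : 𝒰.Z1,
            (∀ (i j : 𝒰.ι) (hij : i < j),
              L.1.res (inf_le_left : 𝒰.set i ⊓ 𝒰.set j ≤ 𝒰.set i)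
                  ((φ i).equiv (𝒰.set i) le_rfl (1 : X.sec (𝒰.set i))) =
                (f.1 ⟨(i, j), hij⟩ : X.sec (𝒰.set i ⊓ 𝒰.set j)) •
                  L.1.res (inf_le_right : 𝒰.set i ⊓ 𝒰.set j ≤ 𝒰.set j)
                    ((φ j).equiv (𝒰.set j) le_rfl (1 : X.sec (𝒰.set j)))) ∧
            Φ L.isoClass = 𝒰.cechClass f := by
  refine ⟨inferInstance, Pic.isoClass_unit, Pic.isoClass_tensor, Pic.mulEquivCechH1 X,
    fun L 𝒰 φ => ?_⟩
  let F : 𝒰.Frame L.1.toSemimodulePresheaf := .ofIso φ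
  exact ⟨F.cocycle, fun i j hij => (F.transition_smul ⟨(i, j), hij⟩).symm,
    InvertibleSheaf.cechClass_eq F⟩

theorem mainTheorem1 (X : SemiringGeometry.SemiringScheme.{u}) :
    -- tensor product makes the isomorphism classes of invertible sheaves an abelian group
    ∃ _ : CommGroup (SemiringGeometry.Pic X.toSemiringedSpace),
      (SemiringGeometry.InvertibleSheaf.unit X.toSemiringedSpace).isoClass = 1 ∧
      (∀ L M : SemiringGeometry.InvertibleSheaf X.toSemiringedSpace,
        (L.tensor M).isoClass = L.isoClass * M.isoClass) ∧
      -- and there is an isomorphism of groups sending a sheaf to the class of its transition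
      -- functions `f_ij`, where `e_i = f_ij e_j` for the generators `e_i = φ_i(1)`
      ∃ Φ : SemiringGeometry.Pic X.toSemiringedSpace ≃*
          SemiringGeometry.CechH1 X.toSemiringedSpace,
        ∀ (L : SemiringGeometry.InvertibleSheaf X.toSemiringedSpace)
          (𝒰 : SemiringGeometry.OpenCover X.toSemiringedSpace)
          (φ : ∀ i, SemiringGeometry.IsoOver (𝒰.set i)
            (SemiringGeometry.structureSheaf X.toSemiringedSpace).toSemimodulePresheaf
            L.1.toSemimodulePresheaf),
          ∃ f : 𝒰.Z1,
            (∀ (i j : 𝒰.ι) (hij : i < j),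
              L.1.res (inf_le_left : 𝒰.set i ⊓ 𝒰.set j ≤ 𝒰.set i)
                  ((φ i).equiv (𝒰.set i) le_rfl (1 : X.sec (𝒰.set i))) =
                (f.1 ⟨(i, j), hij⟩ : X.sec (𝒰.set i ⊓ 𝒰.set j)) •
                  L.1.res (inf_le_right : 𝒰.set i ⊓ 𝒰.set j ≤ 𝒰.set j)
                    ((φ j).equiv (𝒰.set j) le_rfl (1 : X.sec (𝒰.set j)))) ∧
            Φ L.isoClass = 𝒰.cechClass f :=
  mainTheorem1_general X.toSemiringedSpace
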